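/- For $m\ge 0$ let $\mathcal M\subset\mathbb R^m$ be the set of all $(x_1,\dots,x_m)$ with $x_ix_j<1$ for all $1\le i<j\le m$ and $$\prod_{i=1}^m(1-x_i^2)+\sum_{i=1}^m x_i^2\prod_{j\ne i}(1-x_j^2)>0,$$ and let $\overline{\mathcal M}$ be its closure in $\mathbb R^m$. Let $\mathcal C\subset\overline{\mathcal M}$ be a convex set that is symmetric, i.e. invariant under all permutations of the coordinates. Let $M$ be an $m$-dimensional smooth Riemannian manifold, and let $D\subset M$ be a bounded domain with boundary, i.e. a nonempty connected open set whose closure $\overline D$ is compact and whose boundary $\partial D$ is nonempty. Let $f_0,f_1:\overline D\to\mathbb R^n$ be continuous maps that are smooth on $D$ and are minimal maps there, i.e. for $k=0,1$ the graph $\{(x,f_k(x)):x\in D\}$ is a minimal submanifold of the Riemannian product $M\times\mathbb R^n$ (a critical point of the $m$-dimensional area under compactly supported smooth variations). Suppose that $f_0=f_1$ on $\partial D$ and that for every $x\in D$ and $k=0,1$ the singular value vector $(\lambda_1\ge\dots\ge\lambda_m\ge 0)$ of $df_k(x):T_xM\to\mathbb R^n$ (where $\lambda_1^2,\dots,\lambda_m^2$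 are the eigenvalues, with multiplicity, of $df_k(x)^Tdf_k(x)$) lies in $\mathcal C$. Then $f_0=f_1$ on $\overline D$. -/

import Mathlib

open Set MeasureTheory Bundle Manifold
open scoped ContDiff

noncomputable section

namespace MinimalMaps

/-- The set `𝓜 ⊂ ℝᵐ` of vectors with `xᵢ xⱼ < 1` for `i < j` and
`∏ᵢ (1 - xᵢ²) + ∑ᵢ xᵢ² ∏_{j ≠ i} (1 - xⱼ²) > 0`. -/
def setM (m : ℕ) : Set (Fin m → ℝ) :=
  {x | (∀ i j, i < j → x i * x j < 1) ∧
    0 < ∏ i, (1 - x i ^ 2) + ∑ i, x i ^ 2 * ∏ j ∈ Finset.univ.erase i, (1 - x j ^ 2)}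

/-- A subset of `ℝᵐ` is symmetric if it is invariant under permutations of the coordinates. -/
def IsSymmetric {m : ℕ} (C : Set (Fin m → ℝ)) : Prop :=
  ∀ (σ : Equiv.Perm (Fin m)), ∀ x ∈ C, x ∘ σ ∈ C

/-- Tangent spaces of an `m`-manifold are finite dimensional. -/
instance instFiniteDimensionalTangent {m : ℕ} {M : Type*} [TopologicalSpace M]
    [ChartedSpace (EuclideanSpace ℝ (Fin m)) M] (x : M) :
    FiniteDimensional ℝ (TangentSpace (𝓡 m) x) :=
  inferInstanceAs (FiniteDimensional ℝ (EuclideanSpace ℝ (Fin m)))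

section Riemannian

variable {m n : ℕ} {M : Type*} [TopologicalSpace M] [ChartedSpace (EuclideanSpace ℝ (Fin m)) M]
  [RiemannianBundle (fun x : M ↦ TangentSpace (𝓡 m) x)]

/-- The singular value vector `(λ₁ ≥ ⋯ ≥ λₘ)` of `df : T_x M → ℝⁿ`, with respect to the Riemannian
metric on `T_x M` and the Euclidean metric on `ℝⁿ`. -/
def singularValueVector (f : M → EuclideanSpace ℝ (Fin n)) (x : M) : Fin m → ℝ :=
  fun i ↦ LinearMap.singularValues (𝕜 := ℝ)
    (E := TangentSpace (𝓡 m) x) (F := EuclideanSpace ℝ (Fin n))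
    (mfderiv (𝓡 m) (𝓡 n) f x).toLinearMap i

/-- The Gram matrix `⟨∂ᵢX, ∂ⱼX⟩` at the point with coordinates `y` in the chart `e` of `M`, for a
map `X : M → M × ℝⁿ` into the Riemannian product. -/
def gramMatrix (e : OpenPartialHomeomorph M (EuclideanSpace ℝ (Fin m)))
    (X : M → M × EuclideanSpace ℝ (Fin n)) (y : EuclideanSpace ℝ (Fin m)) :
    Matrix (Fin m) (Fin m) ℝ :=
  Matrix.of fun i j ↦
    let Y : EuclideanSpace ℝ (Fin m) → M := fun z ↦ (X (e.symm z)).1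
    let h : EuclideanSpace ℝ (Fin m) → EuclideanSpace ℝ (Fin n) := fun z ↦ (X (e.symm z)).2
    let b : Fin m → EuclideanSpace ℝ (Fin m) := fun k ↦ EuclideanSpace.single k 1
    inner ℝ (E := TangentSpace (𝓡 m) (Y y))
        (mfderiv (𝓡 m) (𝓡 m) Y y (b i)) (mfderiv (𝓡 m) (𝓡 m) Y y (b j))
      + inner ℝ (fderiv ℝ h y (b i)) (fderiv ℝ h y (b j))

/-- The `m`-dimensional area of `X : K → M × ℝⁿ`, where `K` lies in the domain of the chart `e`:
`∫_{e(K)} √(det ⟨∂ᵢX, ∂ⱼX⟩) dy`. -/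
def areaInChart (e : OpenPartialHomeomorph M (EuclideanSpace ℝ (Fin m))) (K : Set M)
    (X : M → M × EuclideanSpace ℝ (Fin n)) : ℝ :=
  ∫ y in e '' K, √(gramMatrix e X y).det

variable (m) in
/-- `X t`, `|t| < ε`, is a smooth variation, with compact support `K`, of the graph
`x ↦ (x, f x)` over `D`, through maps `D → M × ℝⁿ`. The graph may be moved in all directions of
`M × ℝⁿ`, so `X t` need not be a graph. -/
structure IsGraphVariation (D : Set M) (f : M → EuclideanSpace ℝ (Fin n)) (K : Set M) (ε : ℝ)
    (X : ℝ → M → M × EuclideanSpace ℝ (Fin n)) : Prop where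
  isCompact : IsCompact K
  subset : K ⊆ D
  pos : 0 < ε
  contMDiffOn : ContMDiffOn (𝓘(ℝ, ℝ).prod (𝓡 m)) ((𝓡 m).prod (𝓡 n)) ∞
    (fun p : ℝ × M ↦ X p.1 p.2) (Ioo (-ε) ε ×ˢ D)
  zero : ∀ x ∈ D, X 0 x = (x, f x)
  eq_off : ∀ t ∈ Ioo (-ε) ε, ∀ x ∈ D \ K, X t x = (x, f x)

variable (m) in
/-- `f : D → ℝⁿ` is a minimal map on the open set `D ⊂ M`: it is smooth, and its graph is a minimal
submanifold of the Riemannian product `M × ℝⁿ`, i.e. a critical point of the area under compactly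
supported smooth variations. (Being minimal is a local property, so it suffices to use
variations supported in the domain of a chart, where the area is given by the usual integral.) -/
structure IsMinimalMapOn (f : M → EuclideanSpace ℝ (Fin n)) (D : Set M) : Prop where
  contMDiffOn : ContMDiffOn (𝓡 m) (𝓡 n) ∞ f D
  stationary : ∀ e ∈ atlas (EuclideanSpace ℝ (Fin m)) M,
    ∀ (K : Set M) (ε : ℝ) (X : ℝ → M → M × EuclideanSpace ℝ (Fin n)),
      IsGraphVariation m D f K ε X → K ⊆ e.source →
        HasDerivAt (fun t ↦ areaInChart e K (X t)) 0 0

end Riemannian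

end MinimalMaps

end

/-! In orthonormal frames the area density of the graph of a linear map `A` is `∏ √(1 + λᵢ²)`, where
`λ` is the singular value vector of `A`. It is not convex on the space of all linear maps. Its
second derivative at `A` is nonnegative in every direction as soon as the quadratic form `hessForm`
at `λ` is nonnegative, and the second expression defining `setM` is the determinant of that form.
Nonnegativity survives lowering the entries of `λ`. For `A` on a segment from `A₀` to `A₁`, the
singular values of `A` lie entrywise below a convex combination of doubly stochastic images of those
of `A₀` and `A₁`, hence below a point of the symmetric convex set `C`
(`hessForm_singularValues_nonneg`). So the density is convex along the segment, and its slope does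
not decrease from one end to the other (`sq_deriv_le_of_hessForm_nonneg`, `firstVariation_gap`).
Equal slopes force `A₀ = A₁`: the squared density is a positive polynomial in the parameter, so its
root is affine on the segment only if the polynomial is constant, and then the whole line `A₀ + t
(A₁ - A₀)` is bounded.

Let `v = f₁ - f₀`. Testing both weak minimal surface systems with `v` and subtracting would give a
nonnegative integrand of integral zero. As `v` need not have compact support in `D`, it is replaced
by truncations that vanish where `v` is small, and dominated convergence passes to the limit. This
needs bounded differentials (`IsMinimalMapOn.exists_bound`): `C` supplies the bound when `m ≥ 2`,
the geodesic equation when `m = 1`. A partition of unity glues the weak system, given chart by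
chart. The outcome is `df₀ = df₁` wherever `v ≠ 0` (`differential_eq_of_ne`). Hence `‖v‖²` has zero
derivative throughout `D`, is constant by connectedness, and vanishes because it does so at a
boundary point; no unique continuation is involved. -/

noncomputable section

namespace MinimalMaps

/-! ### The Hessian form and the geometry of `setM`. -/

section SetM

variable {m : ℕ}

/-- The Hessian of `∏ √(1 + xᵢ²)` in suitably rescaled coordinates. -/
def hessForm (x ξ : Fin m → ℝ) : ℝ := ∑ i, (1 - x i ^ 2) * ξ i ^ 2 + (∑ i, x i * ξ i) ^ 2

/-- At most one entry `y k` can reach `1`, since `y i * y k < 1`. The other directions are then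
positive, and Cauchy–Schwarz reduces the form to the sign of `1 + (1 - y k ^ 2) * s`, which is the
determinant condition divided by the positive product over `i ≠ k`. -/
theorem hessForm_nonneg_of_mem_setM {y : Fin m → ℝ} (hy : ∀ i, 0 ≤ y i) (h : y ∈ setM m)
    (ξ : Fin m → ℝ) : 0 ≤ hessForm y ξ := by
  obtain ⟨h1, h2⟩ := h
  have h1' : ∀ i j, i ≠ j → y i * y j < 1 := by
    intro i j hij
    rcases lt_or_gt_of_ne hij with h | h
    · exact h1 i j h
    · rw [mul_comm]; exact h1 j i h
  unfold hessForm
  by_cases hk : ∃ k, 1 ≤ y k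
  · obtain ⟨k, hk⟩ := hk
    have hlt : ∀ i ∈ Finset.univ.erase k, 0 < 1 - y i ^ 2 := by
      intro i hi
      have := h1' i k (Finset.ne_of_mem_erase hi)
      nlinarith [hy i]
    rw [← Finset.mul_prod_erase _ _ (Finset.mem_univ k),
      ← Finset.add_sum_erase _ _ (Finset.mem_univ k)] at h2
    rw [← Finset.add_sum_erase _ _ (Finset.mem_univ k),
      ← Finset.add_sum_erase _ (fun i => y i * ξ i) (Finset.mem_univ k)]
    set S := Finset.univ.erase k with hS
    have hkS : ∀ i ∈ S, ∏ j ∈ Finset.univ.erase i, (1 - y j ^ 2)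
        = (1 - y k ^ 2) * ((∏ j ∈ S, (1 - y j ^ 2)) / (1 - y i ^ 2)) := by
      intro i hi
      have hki : k ∈ Finset.univ.erase i := by
        simp only [Finset.mem_erase, Finset.mem_univ, and_true]
        exact (Finset.ne_of_mem_erase hi).symm
      rw [← Finset.mul_prod_erase _ _ hki, ← Finset.mul_prod_erase S _ hi, Finset.erase_right_comm,
        mul_div_cancel_left₀ _ (hlt i hi).ne']
    set Pr := ∏ j ∈ S, (1 - y j ^ 2) with hPr
    have hPpos : 0 < Pr := Finset.prod_pos hlt
    set s := ∑ i ∈ S, y i ^ 2 / (1 - y i ^ 2) with hs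
    have hsum : ∑ i ∈ S, y i ^ 2 * ∏ j ∈ Finset.univ.erase i, (1 - y j ^ 2)
        = (1 - y k ^ 2) * Pr * s := by
      rw [hs, Finset.mul_sum]
      refine Finset.sum_congr rfl fun i hi => ?_
      rw [hkS i hi]; ring
    rw [hsum] at h2
    have hs1 : 0 < 1 + (1 - y k ^ 2) * s := by
      have : 0 < Pr * (1 + (1 - y k ^ 2) * s) := by linarith
      exact pos_of_mul_pos_right this hPpos.le
    set T := ∑ i ∈ S, (1 - y i ^ 2) * ξ i ^ 2 with hT
    set w := ∑ i ∈ S, y i * ξ i with hw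
    have hT0 : 0 ≤ T := Finset.sum_nonneg fun i hi => mul_nonneg (hlt i hi).le (sq_nonneg _)
    have hcs : w ^ 2 ≤ s * T := by
      refine Finset.sum_sq_le_sum_mul_sum_of_sq_le_mul S
        (fun i hi => div_nonneg (sq_nonneg _) (hlt i hi).le)
        (fun i hi => mul_nonneg (hlt i hi).le (sq_nonneg _)) fun i hi => ?_
      have := (hlt i hi).ne'
      apply le_of_eq
      field_simp
    have ha : 0 ≤ y k ^ 2 - 1 := by nlinarith
    nlinarith [sq_nonneg (ξ k + y k * w), mul_le_mul_of_nonneg_left hcs ha, mul_nonneg hs1.le hT0]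
  · push Not at hk
    refine add_nonneg (Finset.sum_nonneg fun i _ => mul_nonneg ?_ (sq_nonneg _)) (sq_nonneg _)
    nlinarith [hk i, hy i]

theorem continuous_hessForm (ξ : Fin m → ℝ) : Continuous fun x => hessForm x ξ := by
  unfold hessForm; fun_prop

/-- Points of `setM` near `x` may have negative entries. Their entrywise absolute values still lie
in `setM`: the determinant condition sees only squares, and `y i * y j > -1` near `x` because `x i *
x j ≥ 0`. -/
theorem hessForm_nonneg_of_mem_closure {x : Fin m → ℝ} (hx : ∀ i, 0 ≤ x i)
    (h : x ∈ closure (setM m)) (ξ : Fin m → ℝ) : 0 ≤ hessForm x ξ := by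
  have hcont : Continuous fun y : Fin m → ℝ => fun i => |y i| := by fun_prop
  have hev : ∀ᶠ y in nhds x, ∀ i j, -1 < y i * y j := by
    refine Filter.eventually_all.2 fun i => Filter.eventually_all.2 fun j => ?_
    have : Continuous fun y : Fin m → ℝ => y i * y j := by fun_prop
    exact this.continuousAt.eventually (lt_mem_nhds (by nlinarith [mul_nonneg (hx i) (hx j)]))
  have hfr := (mem_closure_iff_frequently.1 h).and_eventually hev
  have hfr' : ∃ᶠ y in nhds x, 0 ≤ hessForm (fun i => |y i|) ξ := by
    refine hfr.mono fun y hy => ?_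
    refine hessForm_nonneg_of_mem_setM (fun i => abs_nonneg _) ⟨fun i j hij => ?_, ?_⟩ ξ
    · rw [← abs_mul]
      exact abs_lt.2 ⟨hy.2 i j, hy.1.1 i j hij⟩
    · simpa only [sq_abs] using hy.1.2
  have hlim : Filter.Tendsto (fun y : Fin m → ℝ => hessForm (fun i => |y i|) ξ) (nhds x)
      (nhds (hessForm x ξ)) := by
    have := ((continuous_hessForm ξ).comp hcont).tendsto x
    simpa [Function.comp_def, abs_of_nonneg (hx _)] using this
  by_contra hneg
  exact hfr' ((hlim.eventually (gt_mem_nhds (not_le.1 hneg))).mono fun y hy => not_le.2 hy)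

/-- Writing `x i = θ i * y i` with `θ i ^ 2 ≤ 1`, the form at `x` is the form at `y` in the
direction `θ ξ` plus `∑ (1 - θ i ^ 2) * ξ i ^ 2`. -/
theorem hessForm_nonneg_of_le {x y : Fin m → ℝ} (hx : ∀ i, 0 ≤ x i) (hxy : ∀ i, x i ≤ y i)
    (hy : ∀ ξ, 0 ≤ hessForm y ξ) (ξ : Fin m → ℝ) : 0 ≤ hessForm x ξ := by
  have hθ : ∀ i, ∃ θ : ℝ, x i = θ * y i ∧ θ ^ 2 ≤ 1 := by
    intro i
    rcases eq_or_lt_of_le ((hx i).trans (hxy i)) with h | h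
    · exact ⟨0, by linarith [hx i, hxy i], by norm_num⟩
    · refine ⟨x i / y i, by field_simp, ?_⟩
      rw [div_pow, div_le_one (by positivity)]
      exact pow_le_pow_left₀ (hx i) (hxy i) 2
  choose θ hθ1 hθ2 using hθ
  have key : hessForm x ξ = hessForm y (fun i => θ i * ξ i) + ∑ i, (1 - θ i ^ 2) * ξ i ^ 2 := by
    unfold hessForm
    rw [add_right_comm, ← Finset.sum_add_distrib]
    congr 1
    · exact Finset.sum_congr rfl fun i _ => by rw [hθ1 i]; ring
    · congr 1
      exact Finset.sum_congr rfl fun i _ => by rw [hθ1 i]; ring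
  rw [key]
  exact add_nonneg (hy _) (Finset.sum_nonneg fun i _ =>
    mul_nonneg (by linarith [hθ2 i]) (sq_nonneg _))

theorem mul_le_one_of_hessForm_nonneg {x : Fin m → ℝ} (hx : ∀ ξ, 0 ≤ hessForm x ξ) {i j : Fin m}
    (hij : i ≠ j) : x i * x j ≤ 1 := by
  -- In this direction the form equals `2 - 2 * x i * x j`.
  have h := hx (Pi.single i 1 - Pi.single j 1)
  unfold hessForm at h
  have e1 : ∀ k, (Pi.single i (1 : ℝ) - Pi.single j 1 : Fin m → ℝ) k ^ 2
      = Pi.single (M := fun _ => ℝ) i 1 k + Pi.single (M := fun _ => ℝ) j 1 k := by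
    intro k
    by_cases hki : k = i
    · subst hki; simp [hij]
    · by_cases hkj : k = j
      · subst hkj; simp [hki]
      · simp [hki, hkj]
  simp only [e1] at h
  simp only [Pi.sub_apply, mul_add, mul_sub, Finset.sum_add_distrib, Finset.sum_sub_distrib,
    Pi.single_apply, mul_ite, mul_one, mul_zero, Finset.sum_ite_eq', Finset.mem_univ,
    if_true] at h
  nlinarith

/-- The mean of `x` and its image under the transposition of `i` and `j` lies in `C` and has both
entries equal to `(x i + x j) / 2`, whose square is at most `1`. -/
theorem le_two_of_mem {C : Set (Fin m → ℝ)} (hCs : IsSymmetric C) (hCc : Convex ℝ C)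
    (hCM : C ⊆ closure (setM m)) (hm : 2 ≤ m) {x : Fin m → ℝ} (hx : x ∈ C) (hx0 : ∀ i, 0 ≤ x i)
    (i : Fin m) : x i ≤ 2 := by
  have : Nontrivial (Fin m) := Fin.nontrivial_iff_two_le.2 hm
  obtain ⟨j, hj⟩ := exists_ne i
  have hz := hCc hx (hCs (Equiv.swap i j) x hx) (by norm_num : (0 : ℝ) ≤ 1 / 2)
    (by norm_num : (0 : ℝ) ≤ 1 / 2) (by norm_num)
  have hz0 : ∀ k, 0 ≤ ((1 / 2 : ℝ) • x + (1 / 2 : ℝ) • (x ∘ Equiv.swap i j)) k := by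
    intro k
    simp only [Pi.add_apply, Pi.smul_apply, Function.comp_apply, smul_eq_mul]
    linarith [hx0 k, hx0 (Equiv.swap i j k)]
  have h := mul_le_one_of_hessForm_nonneg (hessForm_nonneg_of_mem_closure hz0 (hCM hz)) hj
  simp only [Pi.add_apply, Pi.smul_apply, Function.comp_apply, smul_eq_mul, Equiv.swap_apply_left,
    Equiv.swap_apply_right] at h
  nlinarith [hx0 i, hx0 j]

end SetM

/-! ### Doubly stochastic matrices and symmetric convex sets. -/

section Majorization

variable {m : ℕ}

/-- A doubly substochastic matrix is dominated by a doubly stochastic one. -/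
theorem exists_doublyStochastic_ge {P : Matrix (Fin m) (Fin m) ℝ} (h0 : ∀ i j, 0 ≤ P i j)
    (hr : ∀ i, ∑ j, P i j ≤ 1) (hc : ∀ j, ∑ i, P i j ≤ 1) :
    ∃ Q ∈ doublyStochastic ℝ (Fin m), ∀ i j, P i j ≤ Q i j := by
  set r : Fin m → ℝ := fun i => 1 - ∑ j, P i j with hrd
  set c : Fin m → ℝ := fun j => 1 - ∑ i, P i j with hcd
  have hr0 : ∀ i, 0 ≤ r i := fun i => sub_nonneg.2 (hr i)
  have hc0 : ∀ i, 0 ≤ c i := fun i => sub_nonneg.2 (hc i)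
  have hrc : ∑ i, r i = ∑ j, c j := by
    simp only [hrd, hcd, Finset.sum_sub_distrib]
    rw [Finset.sum_comm]
  set s := ∑ i, r i with hs
  have hs0 : 0 ≤ s := Finset.sum_nonneg fun i _ => hr0 i
  -- If the total deficit `s` is `0`, every row deficit vanishes and division by zero does no harm.
  have hrs : ∀ i, r i * s / s = r i := by
    intro i
    rcases eq_or_lt_of_le hs0 with h | h
    · have : r i = 0 := (Finset.sum_eq_zero_iff_of_nonneg fun i _ => hr0 i).1 h.symm i
        (Finset.mem_univ i)
      simp [this]
    · field_simp
  have hcs : ∀ i, c i * s / s = c i := by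
    intro i
    rcases eq_or_lt_of_le hs0 with h | h
    · have : c i = 0 := (Finset.sum_eq_zero_iff_of_nonneg fun i _ => hc0 i).1
        (hrc.symm.trans h.symm) i (Finset.mem_univ i)
      simp [this]
    · field_simp
  -- A rank-one nonnegative correction restores all row and column deficits at once, since both
  -- deficit vectors have the same total `s`.
  refine ⟨Matrix.of fun i j => P i j + r i * c j / s, ?_, fun i j => ?_⟩
  · rw [mem_doublyStochastic_iff_sum]
    refine ⟨fun i j => ?_, fun i => ?_, fun j => ?_⟩
    · exact add_nonneg (h0 i j) (div_nonneg (mul_nonneg (hr0 i) (hc0 j)) hs0)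
    · simp only [Matrix.of_apply, Finset.sum_add_distrib]
      rw [← Finset.sum_div, ← Finset.mul_sum, ← hrc, hrs]
      simp [hrd]
    · simp only [Matrix.of_apply, Finset.sum_add_distrib]
      rw [← Finset.sum_div, ← Finset.sum_mul, ← hs, mul_comm, hcs]
      simp [hcd]
  · simp only [Matrix.of_apply]
    have := div_nonneg (mul_nonneg (hr0 i) (hc0 j)) hs0
    linarith

/-- By Birkhoff's theorem `Q` is a convex combination of permutation matrices. -/
theorem mulVec_mem_of_doublyStochastic {C : Set (Fin m → ℝ)} (hCs : IsSymmetric C)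
    (hCc : Convex ℝ C) {Q : Matrix (Fin m) (Fin m) ℝ} (hQ : Q ∈ doublyStochastic ℝ (Fin m))
    {x : Fin m → ℝ} (hx : x ∈ C) : Q.mulVec x ∈ C := by
  obtain ⟨w, hw0, hw1, hw⟩ := exists_eq_sum_perm_of_mem_doublyStochastic hQ
  rw [← hw, Matrix.sum_mulVec]
  have h := hCc.sum_mem (z := fun σ : Equiv.Perm (Fin m) => x ∘ σ) (fun σ _ => hw0 σ) hw1
    fun σ _ => hCs σ x hx
  convert h using 2 with σ
  rw [Matrix.smul_mulVec, Matrix.permMatrix_mulVec]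

end Majorization

/-! ### Singular values along a segment of linear maps. -/

section SingularValues

/-- Bessel's inequality for an orthogonal family of vectors of norm at most one. -/
theorem sum_inner_sq_le {m : ℕ} {W : Type*} [NormedAddCommGroup W] [InnerProductSpace ℝ W]
    {w : Fin m → W} (hw : ∀ i j, i ≠ j → inner ℝ (w i) (w j) = 0)
    (hw1 : ∀ i, ‖w i‖ ^ 2 ≤ 1) (u : W) : ∑ i, inner ℝ (w i) u ^ 2 ≤ ‖u‖ ^ 2 := by
  have h1 : ‖u - ∑ i, inner ℝ (w i) u • w i‖ ^ 2
      = ‖u‖ ^ 2 - 2 * ∑ i, inner ℝ (w i) u ^ 2 + ∑ i, inner ℝ (w i) u ^ 2 * ‖w i‖ ^ 2 := by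
    rw [norm_sub_sq_real, inner_sum, ← real_inner_self_eq_norm_sq (∑ i, _), sum_inner]
    congr 1
    · congr 2
      refine Finset.sum_congr rfl fun i _ => ?_
      rw [inner_smul_right, real_inner_comm]; ring
    · refine Finset.sum_congr rfl fun i _ => ?_
      rw [inner_sum, Finset.sum_eq_single i]
      · rw [inner_smul_left, inner_smul_right, real_inner_self_eq_norm_sq]
        simp only [conj_trivial]; ring
      · intro j _ hj
        rw [inner_smul_left, inner_smul_right, hw i j hj.symm]; simp
      · simp
  have h2 : ∑ i, inner ℝ (w i) u ^ 2 * ‖w i‖ ^ 2 ≤ ∑ i, inner ℝ (w i) u ^ 2 :=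
    Finset.sum_le_sum fun i _ => mul_le_of_le_one_right (sq_nonneg _) (hw1 i)
  nlinarith [sq_nonneg ‖u - ∑ i, inner ℝ (w i) u • w i‖]

variable {m : ℕ} {V W : Type*} [NormedAddCommGroup V] [InnerProductSpace ℝ V]
  [FiniteDimensional ℝ V] [NormedAddCommGroup W] [InnerProductSpace ℝ W] [FiniteDimensional ℝ W]

theorem exists_orthonormalBasis_inner_map (hV : Module.finrank ℝ V = m) (A : V →ₗ[ℝ] W) :
    ∃ o : OrthonormalBasis (Fin m) ℝ V, ∀ i j,
      inner ℝ (A (o i)) (A (o j)) = if i = j then A.singularValues i ^ 2 else 0 := by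
  refine ⟨A.isSymmetric_adjoint_comp_self.eigenvectorBasis hV, fun i j => ?_⟩
  have h := A.isSymmetric_adjoint_comp_self.apply_eigenvectorBasis hV j
  rw [← LinearMap.adjoint_inner_right, ← LinearMap.comp_apply, h, inner_smul_right,
    OrthonormalBasis.inner_eq_ite, A.sq_singularValues_fin hV]
  by_cases hij : i = j
  · subst hij; simp
  · simp [hij]

/-- Orthonormal singular vectors: `A oᵢ = λᵢ wᵢ`, with `wᵢ = 0` where `λᵢ = 0`. -/
theorem exists_singularVectors (hV : Module.finrank ℝ V = m) (A : V →ₗ[ℝ] W) :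
    ∃ (o : OrthonormalBasis (Fin m) ℝ V) (w : Fin m → W),
      (∀ i, A (o i) = A.singularValues i • w i) ∧ (∀ i j, i ≠ j → inner ℝ (w i) (w j) = 0) ∧
      (∀ i, ‖w i‖ ^ 2 ≤ 1) ∧ (∀ i : Fin m, A.singularValues i = inner ℝ (A (o i)) (w i)) ∧
      ∀ i j, inner ℝ (A (o i)) (A (o j)) = if i = j then A.singularValues i ^ 2 else 0 := by
  obtain ⟨o, ho⟩ := exists_orthonormalBasis_inner_map hV A
  have hn : ∀ i, ‖A (o i)‖ ^ 2 = A.singularValues i ^ 2 := fun i => by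
    rw [← real_inner_self_eq_norm_sq, ho]; simp
  refine ⟨o, fun i => (A.singularValues i)⁻¹ • A (o i), fun i => ?_, fun i j hij => ?_,
    fun i => ?_, fun i => ?_, ho⟩
  · by_cases h : A.singularValues i = 0
    · have := hn i
      rw [h] at this
      have : A (o i) = 0 := by simpa using this
      simp [this]
    · rw [smul_inv_smul₀ h]
  · rw [inner_smul_left, inner_smul_right, ho]; simp [hij]
  · rw [norm_smul, mul_pow, hn, Real.norm_eq_abs, sq_abs, ← mul_pow]
    by_cases h : A.singularValues i = 0
    · simp [h]
    · rw [inv_mul_cancel₀ h]; norm_num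
  · rw [inner_smul_right, ho]
    by_cases h : A.singularValues i = 0
    · simp [h]
    · simp only [if_true]; field_simp

/-- The diagonal entries of a linear map in orthonormal systems are dominated by the image of its
singular value vector under a doubly stochastic matrix. -/
theorem exists_doublyStochastic_inner_le (hV : Module.finrank ℝ V = m) (A : V →ₗ[ℝ] W)
    (o : OrthonormalBasis (Fin m) ℝ V) {w : Fin m → W}
    (hw : ∀ i j, i ≠ j → inner ℝ (w i) (w j) = 0) (hw1 : ∀ i, ‖w i‖ ^ 2 ≤ 1) :
    ∃ Q ∈ doublyStochastic ℝ (Fin m), ∀ i,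
      inner ℝ (A (o i)) (w i) ≤ Q.mulVec (fun l => A.singularValues l) i := by
  obtain ⟨o', w', h1, h2, h3, -, -⟩ := exists_singularVectors hV A
  -- The diagonal entry expands as `∑ λ_l ⟨o'_l, o_i⟩ ⟨w'_l, w_i⟩`. The entries of `P` bound these
  -- products by `a b ≤ (a² + b²) / 2`; Parseval and Bessel make `P` substochastic in rows and
  -- columns.
  set P : Matrix (Fin m) (Fin m) ℝ :=
    Matrix.of fun i l => (inner ℝ (o' l) (o i) ^ 2 + inner ℝ (w' l) (w i) ^ 2) / 2 with hP
  have hs : ∀ (b : OrthonormalBasis (Fin m) ℝ V) (v : V), ∑ l, inner ℝ (b l) v ^ 2 = ‖v‖ ^ 2 := by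
    intro b v
    rw [← b.sum_sq_norm_inner_right v]
    simp
  obtain ⟨Q, hQ, hPQ⟩ := exists_doublyStochastic_ge (P := P)
    (fun i j => by simp only [hP, Matrix.of_apply]; positivity)
    (fun i => by
      simp only [hP, Matrix.of_apply]
      rw [← Finset.sum_div, Finset.sum_add_distrib, hs, o.norm_eq_one]
      linarith [sum_inner_sq_le h2 h3 (w i), hw1 i])
    (fun j => by
      simp only [hP, Matrix.of_apply]
      rw [← Finset.sum_div, Finset.sum_add_distrib]
      simp_rw [real_inner_comm _ (o' j), real_inner_comm _ (w' j)]
      rw [hs, o'.norm_eq_one]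
      linarith [sum_inner_sq_le hw hw1 (w' j), h3 j])
  refine ⟨Q, hQ, fun i => ?_⟩
  have hexp : inner ℝ (A (o i)) (w i)
      = ∑ l : Fin m, A.singularValues l * (inner ℝ (o' l) (o i) * inner ℝ (w' l) (w i)) := by
    conv_lhs => rw [← o'.sum_repr' (o i), map_sum, sum_inner]
    refine Finset.sum_congr rfl fun l _ => ?_
    rw [map_smul, h1, inner_smul_left, inner_smul_left]
    simp only [conj_trivial]; ring
  rw [hexp, Matrix.mulVec, dotProduct]
  refine Finset.sum_le_sum fun l _ => ?_
  rw [mul_comm]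
  refine mul_le_mul_of_nonneg_right ?_ (A.singularValues_nonneg l)
  refine le_trans ?_ (hPQ i l)
  simp only [hP, Matrix.of_apply]
  nlinarith [sq_nonneg (inner ℝ (o' l) (o i) - inner ℝ (w' l) (w i))]

/-- Along a segment whose end points have singular values in `C`, the Hessian form at the singular
values is nonnegative. -/
theorem hessForm_singularValues_nonneg {C : Set (Fin m → ℝ)} (hCs : IsSymmetric C)
    (hCc : Convex ℝ C) (hCM : C ⊆ closure (setM m)) (hV : Module.finrank ℝ V = m)
    {A₀ A₁ : V →ₗ[ℝ] W} (h₀ : (fun i : Fin m => A₀.singularValues i) ∈ C)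
    (h₁ : (fun i : Fin m => A₁.singularValues i) ∈ C) {t : ℝ} (ht : t ∈ Icc (0 : ℝ) 1)
    (ξ : Fin m → ℝ) :
    0 ≤ hessForm (fun i : Fin m => (A₀ + t • (A₁ - A₀)).singularValues i) ξ := by
  obtain ⟨o, w, -, h2, h3, h4, -⟩ := exists_singularVectors hV (A₀ + t • (A₁ - A₀))
  obtain ⟨Q₀, hQ₀, hle₀⟩ := exists_doublyStochastic_inner_le hV A₀ o h2 h3
  obtain ⟨Q₁, hQ₁, hle₁⟩ := exists_doublyStochastic_inner_le hV A₁ o h2 h3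
  have hmem := hCc (mulVec_mem_of_doublyStochastic hCs hCc hQ₀ h₀)
    (mulVec_mem_of_doublyStochastic hCs hCc hQ₁ h₁) (sub_nonneg.2 ht.2) ht.1 (by ring)
  -- In its own singular frame the map has its singular values as diagonal entries, and diagonal
  -- entries in a fixed frame are affine in `t`.
  have hle : ∀ i : Fin m, (A₀ + t • (A₁ - A₀)).singularValues i
      ≤ ((1 - t) • Q₀.mulVec (fun i : Fin m => A₀.singularValues i)
        + t • Q₁.mulVec (fun i : Fin m => A₁.singularValues i)) i := by
    intro i
    have : inner ℝ ((A₀ + t • (A₁ - A₀)) (o i)) (w i)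
        = (1 - t) * inner ℝ (A₀ (o i)) (w i) + t * inner ℝ (A₁ (o i)) (w i) := by
      simp only [LinearMap.add_apply, LinearMap.smul_apply, LinearMap.sub_apply, inner_add_left,
        inner_smul_left, inner_sub_left, conj_trivial]
      ring
    rw [h4 i, this]
    simp only [Pi.add_apply, Pi.smul_apply, smul_eq_mul]
    exact add_le_add (mul_le_mul_of_nonneg_left (hle₀ i) (sub_nonneg.2 ht.2))
      (mul_le_mul_of_nonneg_left (hle₁ i) ht.1)
  have h0 : ∀ i : Fin m, 0 ≤ (A₀ + t • (A₁ - A₀)).singularValues i :=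
    fun i => LinearMap.singularValues_nonneg _ _
  exact hessForm_nonneg_of_le h0 hle
    (hessForm_nonneg_of_mem_closure (fun i => (h0 i).trans (hle i)) (hCM hmem)) ξ

theorem norm_map_sq_le_of_singularValues_le (hV : Module.finrank ℝ V = m) {A : V →ₗ[ℝ] W} {R : ℝ}
    (hR : ∀ i : Fin m, A.singularValues i ^ 2 ≤ R) (u : V) : ‖A u‖ ^ 2 ≤ R * ‖u‖ ^ 2 := by
  obtain ⟨o, ho⟩ := exists_orthonormalBasis_inner_map hV A
  have h1 : ‖A u‖ ^ 2 = ∑ i : Fin m, A.singularValues i ^ 2 * inner ℝ (o i) u ^ 2 := by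
    conv_lhs => rw [← o.sum_repr' u, map_sum, ← real_inner_self_eq_norm_sq, sum_inner]
    refine Finset.sum_congr rfl fun i _ => ?_
    rw [inner_sum, Finset.sum_eq_single i]
    · rw [map_smul, inner_smul_left, inner_smul_right, ho]
      simp only [conj_trivial, if_true]; ring
    · intro j _ hj
      rw [map_smul, map_smul, inner_smul_left, inner_smul_right, ho, if_neg hj.symm]; simp
    · simp
  rw [h1, ← o.sum_sq_norm_inner_right u, Finset.mul_sum]
  refine Finset.sum_le_sum fun i _ => ?_
  rw [Real.norm_eq_abs, sq_abs]
  exact mul_le_mul_of_nonneg_right (hR i) (sq_nonneg _)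

end SingularValues

/-! ### First and second derivatives of determinants. -/

section Determinant

variable {m : ℕ}

/-- Jacobi's formula for the derivative of a determinant. -/
theorem hasDerivAt_det {N : ℝ → Matrix (Fin m) (Fin m) ℝ} {N' : Matrix (Fin m) (Fin m) ℝ} {t : ℝ}
    (h : ∀ i j, HasDerivAt (fun s => N s i j) (N' i j) t) :
    HasDerivAt (fun s => (N s).det) ((N t).adjugate * N').trace t := by
  have h1 : HasDerivAt (fun s => (N s).det)
      (∑ σ : Equiv.Perm (Fin m), ((Equiv.Perm.sign σ : ℤ) : ℝ) *
        ∑ i, (∏ j ∈ Finset.univ.erase i, N t (σ j) j) • N' (σ i) i) t := by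
    simp only [Matrix.det_apply']
    exact HasDerivAt.fun_sum fun σ _ =>
      (HasDerivAt.fun_finsetProd fun i _ => h (σ i) i).const_mul _
  convert h1 using 1
  simp only [Finset.mul_sum]
  rw [Finset.sum_comm, Matrix.trace]
  refine Finset.sum_congr rfl fun i _ => ?_
  -- The terms of the Leibniz formula in which column `i` is differentiated make up the determinant
  -- with that column replaced, which is Cramer's expression.
  have h2 : ((N t).adjugate * N').diag i = (N t).cramer (fun k => N' k i) i := by
    rw [Matrix.cramer_eq_adjugate_mulVec]; rfl
  rw [h2, Matrix.cramer_apply, Matrix.det_apply']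
  refine Finset.sum_congr rfl fun σ _ => ?_
  rw [← Finset.mul_prod_erase _ _ (Finset.mem_univ i), Matrix.updateCol_self, smul_eq_mul,
    mul_comm (N' (σ i) i)]
  congr 2
  refine Finset.prod_congr rfl fun j hj => ?_
  rw [Matrix.updateCol_ne (Finset.ne_of_mem_erase hj)]

theorem hasDerivAt_quadratic_entry (N S R : Matrix (Fin m) (Fin m) ℝ) (t : ℝ) (i j : Fin m) :
    HasDerivAt (fun s : ℝ => (N + s • S + s ^ 2 • R) i j) ((S + (2 * t) • R) i j) t := by
  simp only [Matrix.add_apply, Matrix.smul_apply, smul_eq_mul]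
  have h := (((hasDerivAt_id t).mul_const (S i j)).const_add (N i j)).add
    (((hasDerivAt_id t).pow 2).mul_const (R i j))
  refine (h.congr_deriv ?_)
  simp

/-- The second derivative of `det (1 + s S + s² R)` at `s = 0`. -/
theorem hasDerivAt_deriv_det_quadratic (S R : Matrix (Fin m) (Fin m) ℝ) :
    HasDerivAt (fun s : ℝ => ((1 + s • S + s ^ 2 • R).adjugate * (S + (2 * s) • R)).trace)
      (S.trace ^ 2 - (S * S).trace + 2 * R.trace) 0 := by
  set N : ℝ → Matrix (Fin m) (Fin m) ℝ := fun s => 1 + s • S + s ^ 2 • R with hN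
  have hN0 : N 0 = 1 := by simp [hN]
  have hNd : ∀ i j, HasDerivAt (fun s => N s i j) (S i j) 0 := by
    intro i j
    exact (hasDerivAt_quadratic_entry 1 S R 0 i j).congr_deriv (by simp)
  have hX : ∀ i j, ∃ x, HasDerivAt (fun s => (N s).adjugate i j) x 0 := by
    intro i j
    simp only [Matrix.adjugate_apply]
    refine ⟨_, hasDerivAt_det (N' := S.updateRow j 0) fun k l => ?_⟩
    by_cases hk : k = j
    · subst hk
      simpa using hasDerivAt_const (0 : ℝ) _
    · simpa [Matrix.updateRow_ne hk] using hNd k l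
  choose X hX using hX
  have hdet : HasDerivAt (fun s => (N s).det) S.trace 0 := by
    have := hasDerivAt_det hNd
    rwa [hN0, Matrix.adjugate_one, one_mul] at this
  -- The derivative of the adjugate at the identity comes from differentiating `adj N * N = det N •
  -- 1`: it satisfies `X + S = tr S • 1`.
  have hmul : ∀ i j, X i j = S.trace * (1 : Matrix (Fin m) (Fin m) ℝ) i j - S i j := by
    intro i j
    have h1 : HasDerivAt (fun s => ((N s).adjugate * N s) i j)
        (∑ k, (X i k * N 0 k j + (N 0).adjugate i k * S k j)) 0 := by
      simp only [Matrix.mul_apply]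
      exact HasDerivAt.fun_sum fun k _ => (hX i k).mul (hNd k j)
    have h2 : HasDerivAt (fun s => ((N s).adjugate * N s) i j)
        (S.trace * (1 : Matrix (Fin m) (Fin m) ℝ) i j) 0 := by
      simp only [Matrix.adjugate_mul, Matrix.smul_apply, smul_eq_mul]
      exact hdet.mul_const _
    have h3 := h1.unique h2
    rw [hN0, Matrix.adjugate_one, Finset.sum_add_distrib] at h3
    have h4 : ∑ k, X i k * (1 : Matrix (Fin m) (Fin m) ℝ) k j = X i j := by
      simp [Matrix.one_apply]
    have h5 : ∑ k, (1 : Matrix (Fin m) (Fin m) ℝ) i k * S k j = S i j := by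
      simp [Matrix.one_apply]
    linarith
  have hmain : HasDerivAt (fun s : ℝ => ((N s).adjugate * (S + (2 * s) • R)).trace)
      (∑ i, ∑ k, (X i k * (S + (2 * (0 : ℝ)) • R) k i + (N 0).adjugate i k * (2 * R k i))) 0 := by
    simp only [Matrix.trace, Matrix.diag, Matrix.mul_apply]
    refine HasDerivAt.fun_sum fun i _ => HasDerivAt.fun_sum fun k _ => (hX i k).mul ?_
    simp only [Matrix.add_apply, Matrix.smul_apply, smul_eq_mul]
    have h := (((hasDerivAt_id (0 : ℝ)).const_mul 2).mul_const (R k i)).const_add (S k i)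
    simpa using h
  refine hmain.congr_deriv ?_
  rw [hN0, Matrix.adjugate_one]
  simp only [hmul, Finset.sum_add_distrib, sub_mul, Finset.sum_sub_distrib, mul_zero, zero_smul,
    add_zero]
  have e1 : ∑ i, ∑ k, S.trace * (1 : Matrix (Fin m) (Fin m) ℝ) i k * S k i = S.trace ^ 2 := by
    simp only [mul_assoc, ← Finset.mul_sum]
    simp [Matrix.one_apply, Matrix.trace, sq]
  have e2 : ∑ i, ∑ k, S i k * S k i = (S * S).trace := by
    simp [Matrix.trace, Matrix.mul_apply]
  have e3 : ∑ i, ∑ k, (1 : Matrix (Fin m) (Fin m) ℝ) i k * (2 * R k i) = 2 * R.trace := by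
    simp [Matrix.one_apply, Matrix.trace, Finset.mul_sum]
  rw [e1, e2, e3]

end Determinant

/-! ### The area density of a graph and its first variation. -/

section AreaDensity

variable {m : ℕ} {W : Type*} [NormedAddCommGroup W] [InnerProductSpace ℝ W]

/-- The matrix of inner products `⟨Pᵢ, Qⱼ⟩`. -/
def crossGram (P Q : Fin m → W) : Matrix (Fin m) (Fin m) ℝ :=
  Matrix.of fun i j => inner ℝ (P i) (Q j)

/-- The metric induced on the graph of a map with partial derivatives `P`. -/
def inducedMetric (g : Matrix (Fin m) (Fin m) ℝ) (P : Fin m → W) : Matrix (Fin m) (Fin m) ℝ :=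
  g + crossGram P P

/-- The derivative of `√det (inducedMetric g P)` in the direction `Q`. -/
def firstVariation (g : Matrix (Fin m) (Fin m) ℝ) (P Q : Fin m → W) : ℝ :=
  ((inducedMetric g P).adjugate * (crossGram P Q + crossGram Q P)).trace /
    (2 * √(inducedMetric g P).det)

theorem det_inducedMetric_pos {g : Matrix (Fin m) (Fin m) ℝ} (hg : g.PosDef) (P : Fin m → W) :
    0 < (inducedMetric g P).det :=
  (hg.add_posSemidef (Matrix.posSemidef_gram ℝ P)).det_pos

theorem inducedMetric_add_smul (g : Matrix (Fin m) (Fin m) ℝ) (P Q : Fin m → W) (t : ℝ) :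
    inducedMetric g (P + t • Q)
      = inducedMetric g P + t • (crossGram P Q + crossGram Q P) + t ^ 2 • crossGram Q Q := by
  ext i j
  simp only [inducedMetric, crossGram, Matrix.add_apply, Matrix.smul_apply, Matrix.of_apply,
    Pi.add_apply, Pi.smul_apply, inner_add_left, inner_add_right, inner_smul_left,
    inner_smul_right, smul_eq_mul, conj_trivial]
  ring

theorem crossGram_add_smul (P Q : Fin m → W) (t : ℝ) :
    crossGram (P + t • Q) Q + crossGram Q (P + t • Q)
      = crossGram P Q + crossGram Q P + (2 * t) • crossGram Q Q := by
  ext i j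
  simp only [crossGram, Matrix.add_apply, Matrix.smul_apply, Matrix.of_apply,
    Pi.add_apply, Pi.smul_apply, inner_add_left, inner_add_right, inner_smul_left,
    inner_smul_right, smul_eq_mul, conj_trivial]
  ring

theorem hasDerivAt_det_inducedMetric (g : Matrix (Fin m) (Fin m) ℝ) (P Q : Fin m → W) (t : ℝ) :
    HasDerivAt (fun s : ℝ => (inducedMetric g (P + s • Q)).det)
      ((inducedMetric g (P + t • Q)).adjugate *
        (crossGram (P + t • Q) Q + crossGram Q (P + t • Q))).trace t := by
  rw [crossGram_add_smul]
  refine hasDerivAt_det fun i j => ?_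
  simp only [inducedMetric_add_smul]
  exact hasDerivAt_quadratic_entry _ _ _ t i j

theorem hasDerivAt_sqrt_det_inducedMetric {g : Matrix (Fin m) (Fin m) ℝ} (hg : g.PosDef)
    (P Q : Fin m → W) (t : ℝ) :
    HasDerivAt (fun s : ℝ => √(inducedMetric g (P + s • Q)).det)
      (firstVariation g (P + t • Q) Q) t :=
  (hasDerivAt_det_inducedMetric g P Q t).sqrt (det_inducedMetric_pos hg _).ne'

/-- Polynomiality, beyond smoothness, is what makes the equality case rigid: information on `[0, 1]`
spreads to the whole line. -/
theorem exists_polynomial_det_inducedMetric (g : Matrix (Fin m) (Fin m) ℝ) (P Q : Fin m → W) :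
    ∃ p : Polynomial ℝ, ∀ t, (inducedMetric g (P + t • Q)).det = p.eval t := by
  refine ⟨(Matrix.of fun i j => Polynomial.C (inducedMetric g P i j) +
    Polynomial.X * Polynomial.C ((crossGram P Q + crossGram Q P) i j) +
    Polynomial.X ^ 2 * Polynomial.C (crossGram Q Q i j)).det, fun t => ?_⟩
  rw [← Polynomial.coe_evalRingHom, RingHom.map_det, inducedMetric_add_smul]
  congr 1
  ext i j
  simp only [Matrix.add_apply, Matrix.smul_apply, smul_eq_mul, RingHom.mapMatrix_apply,
    Matrix.map_apply, Matrix.of_apply, Polynomial.coe_evalRingHom, Polynomial.eval_add,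
    Polynomial.eval_mul, Polynomial.eval_C, Polynomial.eval_X, Polynomial.eval_pow]

/-- Change of frame by the matrix `T`. -/
theorem crossGram_changeFrame (T : Matrix (Fin m) (Fin m) ℝ) (P Q : Fin m → W) :
    crossGram (fun i => ∑ j, T j i • P j) (fun i => ∑ j, T j i • Q j)
      = T.transpose * crossGram P Q * T := by
  ext i j
  simp only [crossGram, Matrix.of_apply, sum_inner, inner_sum, inner_smul_left, inner_smul_right,
    Matrix.mul_apply, Matrix.transpose_apply, Finset.sum_mul, Finset.mul_sum, conj_trivial]
  refine Finset.sum_congr rfl fun k _ => Finset.sum_congr rfl fun l _ => ?_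
  ring

theorem inducedMetric_changeFrame (T g : Matrix (Fin m) (Fin m) ℝ) (P : Fin m → W) :
    inducedMetric (T.transpose * g * T) (fun i => ∑ j, T j i • P j)
      = T.transpose * inducedMetric g P * T := by
  rw [inducedMetric, inducedMetric, crossGram_changeFrame, Matrix.mul_add, Matrix.add_mul]

/-- The first variation transforms as a density, so that its integral does not depend on the chart.
-/
theorem firstVariation_changeFrame {T g : Matrix (Fin m) (Fin m) ℝ} (hT : T.det ≠ 0)
    (P Q : Fin m → W) :
    firstVariation (T.transpose * g * T) (fun i => ∑ j, T j i • P j) (fun i => ∑ j, T j i • Q j)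
      = |T.det| * firstVariation g P Q := by
  have h1 : √(T.transpose * inducedMetric g P * T).det = |T.det| * √(inducedMetric g P).det := by
    rw [Matrix.det_mul, Matrix.det_mul, Matrix.det_transpose, mul_right_comm, ← sq,
      Real.sqrt_mul (sq_nonneg _), Real.sqrt_sq_eq_abs]
  have h2 : ((T.transpose * inducedMetric g P * T).adjugate *
      (T.transpose * (crossGram P Q + crossGram Q P) * T)).trace
      = T.det ^ 2 * ((inducedMetric g P).adjugate * (crossGram P Q + crossGram Q P)).trace := by
    have e : (T.transpose * inducedMetric g P * T).adjugate *
        (T.transpose * (crossGram P Q + crossGram Q P) * T)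
        = T.det • (T.adjugate * ((inducedMetric g P).adjugate *
          (crossGram P Q + crossGram Q P) * T)) := by
      rw [Matrix.adjugate_mul_distrib, Matrix.adjugate_mul_distrib]
      have : T.transpose.adjugate * T.transpose = T.det • (1 : Matrix (Fin m) (Fin m) ℝ) := by
        rw [Matrix.adjugate_mul, Matrix.det_transpose]
      calc _ = T.adjugate * ((inducedMetric g P).adjugate *
            ((T.transpose.adjugate * T.transpose) * ((crossGram P Q + crossGram Q P) * T))) := by
              simp only [Matrix.mul_assoc]
        _ = _ := by
          rw [this]
          simp only [Matrix.smul_mul, Matrix.mul_smul, Matrix.one_mul, Matrix.mul_assoc]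
    rw [e, Matrix.trace_smul, Matrix.trace_mul_comm, Matrix.mul_assoc, Matrix.mul_adjugate]
    simp only [Matrix.mul_smul, Matrix.mul_one, Matrix.trace_smul, smul_eq_mul]
    ring
  rw [firstVariation, inducedMetric_changeFrame, crossGram_changeFrame, crossGram_changeFrame,
    ← Matrix.add_mul, ← Matrix.mul_add, h1, h2, firstVariation, ← sq_abs T.det]
  have := abs_pos.2 hT
  field_simp

theorem firstVariation_add (g : Matrix (Fin m) (Fin m) ℝ) (P Q Q' : Fin m → W) :
    firstVariation g P (Q + Q') = firstVariation g P Q + firstVariation g P Q' := by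
  have : crossGram P (Q + Q') + crossGram (Q + Q') P
      = (crossGram P Q + crossGram Q P) + (crossGram P Q' + crossGram Q' P) := by
    ext i j
    simp only [crossGram, Matrix.add_apply, Matrix.of_apply, Pi.add_apply, inner_add_left,
      inner_add_right]
    ring
  rw [firstVariation, this, Matrix.mul_add, Matrix.trace_add, add_div]
  rfl

theorem firstVariation_smul (g : Matrix (Fin m) (Fin m) ℝ) (P Q : Fin m → W) (a : ℝ) :
    firstVariation g P (a • Q) = a * firstVariation g P Q := by
  have : crossGram P (a • Q) + crossGram (a • Q) P = a • (crossGram P Q + crossGram Q P) := by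
    ext i j
    simp only [crossGram, Matrix.add_apply, Matrix.smul_apply, Matrix.of_apply, Pi.smul_apply,
      inner_smul_left, inner_smul_right, smul_eq_mul, conj_trivial]
    ring
  rw [firstVariation, this, Matrix.mul_smul, Matrix.trace_smul, smul_eq_mul, mul_div_assoc]
  rfl

theorem firstVariation_sum {ι : Type*} (g : Matrix (Fin m) (Fin m) ℝ) (P : Fin m → W)
    (s : Finset ι) (Q : ι → Fin m → W) :
    firstVariation g P (∑ a ∈ s, Q a) = ∑ a ∈ s, firstVariation g P (Q a) := by
  classical
  induction s using Finset.induction_on with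
  | empty => simpa using firstVariation_smul g P 0 0
  | insert a s ha ih => rw [Finset.sum_insert ha, Finset.sum_insert ha, firstVariation_add, ih]

theorem continuousOn_crossGram {X : Type*} [TopologicalSpace X] {s : Set X} {P Q : X → Fin m → W}
    (hP : ContinuousOn P s) (hQ : ContinuousOn Q s) :
    ContinuousOn (fun x => crossGram (P x) (Q x)) s := by
  refine continuousOn_pi.2 fun i => continuousOn_pi.2 fun j => ?_
  exact (continuousOn_pi.1 hP i).inner (𝕜 := ℝ) (continuousOn_pi.1 hQ j)

theorem continuousOn_firstVariation {X : Type*} [TopologicalSpace X] {s : Set X}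
    {g : X → Matrix (Fin m) (Fin m) ℝ} {P Q : X → Fin m → W} (hg : ContinuousOn g s)
    (hP : ContinuousOn P s) (hQ : ContinuousOn Q s) (hpos : ∀ x ∈ s, (g x).PosDef) :
    ContinuousOn (fun x => firstVariation (g x) (P x) (Q x)) s := by
  have hN : ContinuousOn (fun x => inducedMetric (g x) (P x)) s :=
    hg.add (continuousOn_crossGram hP hP)
  have hd : ContinuousOn (fun x => (inducedMetric (g x) (P x)).det) s :=
    (Continuous.matrix_det continuous_id).comp_continuousOn hN
  have ha : ContinuousOn (fun x => (inducedMetric (g x) (P x)).adjugate) s :=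
    (Continuous.matrix_adjugate continuous_id).comp_continuousOn hN
  have hS := (continuousOn_crossGram hP hQ).add (continuousOn_crossGram hQ hP)
  have hm : ContinuousOn (fun x => ((inducedMetric (g x) (P x)).adjugate *
      (crossGram (P x) (Q x) + crossGram (Q x) (P x))).trace) s := by
    simp only [Matrix.trace, Matrix.diag, Matrix.mul_apply]
    exact continuousOn_finsetSum _ fun i _ => continuousOn_finsetSum _ fun k _ =>
      (continuousOn_pi.1 (continuousOn_pi.1 ha i) k).mul
        (continuousOn_pi.1 (continuousOn_pi.1 hS k) i)
  unfold firstVariation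
  have hd2 : ContinuousOn (fun x => 2 * √(inducedMetric (g x) (P x)).det) s :=
    continuousOn_const.mul hd.sqrt
  refine ContinuousOn.div₀ hm hd2 fun x hx => ?_
  have := Real.sqrt_pos.2 (det_inducedMetric_pos (hpos x hx) (P x))
  positivity

end AreaDensity

/-! ### Convexity of the area density along segments, and rigidity. -/

section Convexity

/-- If `√p` is convex on `[0, 1]` for a polynomial `p > 0`, then its slope is larger at `1` than at
`0`, unless `p` is constant. -/
theorem slope_sqrt_polynomial {p : Polynomial ℝ} (hp : ∀ t, 0 < p.eval t)
    (hconv : ∀ t ∈ Icc (0 : ℝ) 1, p.derivative.eval t ^ 2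
      ≤ 2 * p.eval t * p.derivative.derivative.eval t) :
    p.derivative.eval 0 / (2 * √(p.eval 0)) ≤ p.derivative.eval 1 / (2 * √(p.eval 1)) ∧
    (p.derivative.eval 0 / (2 * √(p.eval 0)) = p.derivative.eval 1 / (2 * √(p.eval 1)) →
      ∀ t, p.eval t = p.eval 0) := by
  set φ : ℝ → ℝ := fun t => p.derivative.eval t / (2 * √(p.eval t)) with hφ
  have hs : ∀ t, 0 < √(p.eval t) := fun t => Real.sqrt_pos.2 (hp t)
  have hF : ∀ t, HasDerivAt (fun t => √(p.eval t)) (φ t) t := fun t =>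
    (p.hasDerivAt t).sqrt (hp t).ne'
  have hd : ∀ t, HasDerivAt φ ((2 * p.eval t * p.derivative.derivative.eval t
      - p.derivative.eval t ^ 2) / (4 * p.eval t * √(p.eval t))) t := by
    intro t
    have h := (p.derivative.hasDerivAt t).div ((hF t).const_mul 2) (by have := hs t; positivity)
    refine h.congr_deriv ?_
    have h1 := (hs t).ne'
    have h2 : √(p.eval t) ^ 2 = p.eval t := Real.sq_sqrt (hp t).le
    simp only [hφ]
    rw [← h2]
    field_simp
    rw [Real.sqrt_sq (hs t).le]
    field_simp
    ring
  have hmono : MonotoneOn φ (Icc 0 1) := by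
    refine monotoneOn_of_deriv_nonneg (convex_Icc 0 1)
      (fun t _ => (hd t).continuousAt.continuousWithinAt)
      (fun t _ => (hd t).differentiableAt.differentiableWithinAt) fun t ht => ?_
    rw [interior_Icc] at ht
    rw [(hd t).deriv]
    refine div_nonneg (sub_nonneg.2 (hconv t ⟨ht.1.le, ht.2.le⟩)) ?_
    have := hp t; have := hs t
    positivity
  have h0 : (0 : ℝ) ∈ Icc (0 : ℝ) 1 := by simp
  have h1 : (1 : ℝ) ∈ Icc (0 : ℝ) 1 := by simp
  refine ⟨hmono h0 h1 zero_le_one, fun heq => ?_⟩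
  have hconst : ∀ t ∈ Icc (0 : ℝ) 1, φ t = φ 0 := fun t ht =>
    le_antisymm ((hmono ht h1 ht.2).trans_eq heq.symm) (hmono h0 ht ht.1)
  have hlin : ∀ t ∈ Icc (0 : ℝ) 1, √(p.eval t) = √(p.eval 0) + φ 0 * t := by
    have := constant_of_has_deriv_right_zero (f := fun t => √(p.eval t) - φ 0 * t) (a := 0) (b := 1)
      (fun t _ => ((hF t).continuousAt.sub (by fun_prop)).continuousWithinAt)
      (fun t ht => by
        have h := ((hF t).sub ((hasDerivAt_id t).const_mul (φ 0))).hasDerivWithinAt (s := Ici t)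
        have e := hconst t ⟨ht.1, ht.2.le⟩
        rw [e, mul_one, sub_self] at h
        exact h)
    intro t ht
    have := this t ht
    simp only [mul_zero, sub_zero] at this
    linarith
  -- On `[0, 1]` the root of `p` is affine; an identity of polynomials on an infinite set is an
  -- identity.
  have hpoly : p = (Polynomial.C √(p.eval 0) + Polynomial.C (φ 0) * Polynomial.X) ^ 2 := by
    refine Polynomial.eq_of_infinite_eval_eq _ _
      ((Icc_infinite (zero_lt_one (α := ℝ))).mono fun t ht => ?_)
    simp only [mem_ofPred_eq, Polynomial.eval_pow, Polynomial.eval_add, Polynomial.eval_mul,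
      Polynomial.eval_C, Polynomial.eval_X]
    rw [← hlin t ht, Real.sq_sqrt (hp t).le]
  have heval : ∀ t, p.eval t = (√(p.eval 0) + φ 0 * t) ^ 2 := fun t => by
    conv_lhs => rw [hpoly]
    simp
  -- A nonconstant affine function has a real zero, where `p` would vanish.
  have hb : φ 0 = 0 := by
    by_contra hb
    have h := hp (-√(p.eval 0) / φ 0)
    rw [heval] at h
    have : √(p.eval 0) + φ 0 * (-√(p.eval 0) / φ 0) = 0 := by field_simp; ring
    rw [this] at h
    norm_num at h
  intro t
  rw [heval t, hb]
  simp [Real.sq_sqrt (hp 0).le]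

variable {m : ℕ} {V W : Type*} [NormedAddCommGroup V] [InnerProductSpace ℝ V]
  [FiniteDimensional ℝ V] [NormedAddCommGroup W] [InnerProductSpace ℝ W] [FiniteDimensional ℝ W]

/-- The normalisation of `κ` turns the last two terms into a sum of `e i j`. Off the diagonal, `e i
j` is half of `a² + b² - 2 x_i x_j a b`, nonnegative because `0 ≤ x_i x_j ≤ 1`; the diagonal terms
and the square add up to `hessForm` at `κ i * β i i`. -/
theorem trace_sq_le_of_hessForm_nonneg {x κ : Fin m → ℝ} {β : Fin m → Fin m → ℝ}
    (hx : ∀ ξ, 0 ≤ hessForm x ξ) (hx0 : ∀ i, 0 ≤ x i) (hκ : ∀ i, κ i ^ 2 * (1 + x i ^ 2) = 1) :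
    0 ≤ (∑ i, x i * κ i * β i i) ^ 2 + ∑ i, ∑ j, β i j ^ 2
      - (∑ i, ∑ j, (x i * κ i * β i j + x j * κ j * β j i) ^ 2) / 2 := by
  set e : Fin m → Fin m → ℝ := fun i j =>
    ((κ i * β i j) ^ 2 + (κ j * β j i) ^ 2 - 2 * (x i * x j) * (κ i * β i j) * (κ j * β j i)) / 2
    with he
  have h1 : ∑ i, ∑ j, β i j ^ 2
      - (∑ i, ∑ j, (x i * κ i * β i j + x j * κ j * β j i) ^ 2) / 2 = ∑ i, ∑ j, e i j := by
    have hsym : ∑ i, ∑ j, β i j ^ 2 = ∑ i, ∑ j, (β i j ^ 2 + β j i ^ 2) / 2 := by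
      have : ∑ i, ∑ j, β j i ^ 2 = ∑ i, ∑ j, β i j ^ 2 := Finset.sum_comm
      simp only [add_div, Finset.sum_add_distrib, ← Finset.sum_div]
      rw [this]; ring
    rw [hsym, Finset.sum_div, ← Finset.sum_sub_distrib]
    refine Finset.sum_congr rfl fun i _ => ?_
    rw [Finset.sum_div, ← Finset.sum_sub_distrib]
    refine Finset.sum_congr rfl fun j _ => ?_
    simp only [he]
    linear_combination (-(β i j) ^ 2 / 2) * hκ i + (-(β j i) ^ 2 / 2) * hκ j
  have h2 : ∀ i j, i ≠ j → 0 ≤ e i j := by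
    intro i j hij
    have hxx := mul_le_one_of_hessForm_nonneg hx hij
    have hxx0 := mul_nonneg (hx0 i) (hx0 j)
    simp only [he]
    generalize κ i * β i j = a
    generalize κ j * β j i = b
    generalize x i * x j = c at *
    nlinarith [mul_nonneg hxx0 (sq_nonneg (a - b)), mul_nonneg (sub_nonneg.2 hxx) (sq_nonneg a),
      mul_nonneg (sub_nonneg.2 hxx) (sq_nonneg b)]
  have h3 : ∑ i, e i i ≤ ∑ i, ∑ j, e i j := by
    refine Finset.sum_le_sum fun i _ => ?_
    rw [← Finset.add_sum_erase _ _ (Finset.mem_univ i)]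
    exact le_add_of_nonneg_right
      (Finset.sum_nonneg fun j hj => h2 i j (Finset.ne_of_mem_erase hj).symm)
  have h4 : hessForm x (fun i => κ i * β i i) = ∑ i, e i i + (∑ i, x i * κ i * β i i) ^ 2 := by
    unfold hessForm
    congr 1
    · refine Finset.sum_congr rfl fun i _ => ?_
      simp only [he]; ring
    · congr 1
      exact Finset.sum_congr rfl fun i _ => by ring
  have := hx fun i => κ i * β i i
  linarith

/-- The inequality behind the convexity of `t ↦ √det (inducedMetric g (P + t Q))` at `t = 0`. -/
theorem sq_deriv_le_of_hessForm_nonneg (hV : Module.finrank ℝ V = m) (A B : V →ₗ[ℝ] W)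
    (hA : ∀ ξ, 0 ≤ hessForm (fun i : Fin m => A.singularValues i) ξ) (c : Fin m → V)
    {p : Polynomial ℝ} (hp : ∀ t : ℝ, (inducedMetric (Matrix.gram ℝ c)
      ((fun i => A (c i)) + t • fun i => B (c i))).det = p.eval t) :
    p.derivative.eval 0 ^ 2 ≤ 2 * p.eval 0 * p.derivative.derivative.eval 0 := by
  obtain ⟨o, w, h1, h2, h3, -, hAA⟩ := exists_singularVectors hV A
  set x : Fin m → ℝ := fun i => A.singularValues i with hx
  have hx0 : ∀ i, 0 ≤ x i := fun i => A.singularValues_nonneg i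
  set κ : Fin m → ℝ := fun i => (√(1 + x i ^ 2))⁻¹ with hκ
  have hκ0 : ∀ i, κ i ≠ 0 := fun i => by simp only [hκ]; positivity
  have hκ1 : ∀ i, κ i ^ 2 * (1 + x i ^ 2) = 1 := fun i => by
    simp only [hκ]
    rw [inv_pow, Real.sq_sqrt (by positivity), inv_mul_cancel₀ (by positivity)]
  set c' : Fin m → V := fun i => κ i • o i with hc'
  set T : Matrix (Fin m) (Fin m) ℝ := Matrix.of fun j i => (κ j)⁻¹ * inner ℝ (o j) (c i) with hT
  have hcT : ∀ i, c i = ∑ j, T j i • c' j := by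
    intro i
    conv_lhs => rw [← o.sum_repr' (c i)]
    refine Finset.sum_congr rfl fun j _ => ?_
    simp only [hT, hc', Matrix.of_apply, smul_smul]
    congr 1
    have := hκ0 j
    field_simp
  set S := crossGram (fun i => A (c' i)) (fun i => B (c' i))
    + crossGram (fun i => B (c' i)) (fun i => A (c' i)) with hS
  set R := crossGram (fun i => B (c' i)) (fun i => B (c' i)) with hR
  have hone : inducedMetric (Matrix.gram ℝ c') (fun i => A (c' i)) = 1 := by
    ext i j
    simp only [inducedMetric, crossGram, Matrix.add_apply, Matrix.gram_apply, Matrix.of_apply, hc',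
      map_smul, inner_smul_left, inner_smul_right, conj_trivial, hAA, o.inner_eq_ite,
      Matrix.one_apply]
    by_cases hij : i = j
    · subst hij
      simp only [if_true]
      linarith [hκ1 i]
    · simp [hij]
  have hdet : ∀ t : ℝ, p.eval t = T.det ^ 2 * (1 + t • S + t ^ 2 • R).det := by
    intro t
    have e1 : Matrix.gram ℝ c = T.transpose * Matrix.gram ℝ c' * T := by
      have := crossGram_changeFrame T c' c'
      rw [← funext hcT] at this
      exact this
    have e2 : ((fun i => A (c i)) + t • fun i => B (c i))
        = fun i => ∑ j, T j i • ((fun i => A (c' i)) + t • fun i => B (c' i)) j := by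
      funext i
      simp only [Pi.add_apply, Pi.smul_apply, smul_add, Finset.sum_add_distrib]
      conv_lhs => rw [hcT i]
      simp only [map_sum, map_smul, Finset.smul_sum, smul_comm t]
    rw [← hp, e1, e2, inducedMetric_changeFrame, inducedMetric_add_smul, hone, Matrix.det_mul,
      Matrix.det_mul, Matrix.det_transpose]
    ring
  have hd1 : ∀ t : ℝ, p.derivative.eval t
      = T.det ^ 2 * ((1 + t • S + t ^ 2 • R).adjugate * (S + (2 * t) • R)).trace := by
    intro t
    refine (p.hasDerivAt t).unique ?_
    simp only [hdet]
    exact (hasDerivAt_det (hasDerivAt_quadratic_entry 1 S R t)).const_mul _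
  have hd2 : p.derivative.derivative.eval 0
      = T.det ^ 2 * (S.trace ^ 2 - (S * S).trace + 2 * R.trace) := by
    refine (p.derivative.hasDerivAt 0).unique ?_
    simp only [hd1]
    exact (hasDerivAt_deriv_det_quadratic S R).const_mul _
  set β : Fin m → Fin m → ℝ := fun i j => inner ℝ (w i) (B (c' j)) with hβ
  have hSe : ∀ i j, S i j = x i * κ i * β i j + x j * κ j * β j i := by
    intro i j
    have hac : ∀ k, A (c' k) = (x k * κ k) • w k := fun k => by
      simp only [hc', map_smul, h1, smul_smul, hx]
      rw [mul_comm]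
    simp only [hS, crossGram, Matrix.add_apply, Matrix.of_apply, hac, inner_smul_left,
      inner_smul_right, conj_trivial, hβ, real_inner_comm (w j)]
  -- Components of `B` orthogonal to the `w i` only increase the trace of `R`, so Bessel's
  -- inequality goes the useful way.
  have hR1 : ∑ i, ∑ j, β i j ^ 2 ≤ R.trace := by
    rw [Finset.sum_comm]
    refine Finset.sum_le_sum fun j _ => ?_
    refine (sum_inner_sq_le h2 h3 (B (c' j))).trans_eq ?_
    simp only [hR, crossGram, Matrix.diag_apply, Matrix.of_apply, real_inner_self_eq_norm_sq]
  have hStr : S.trace = 2 * ∑ i, x i * κ i * β i i := by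
    simp only [Matrix.trace, Matrix.diag_apply, hSe, Finset.mul_sum]
    exact Finset.sum_congr rfl fun i _ => by ring
  have hSS : (S * S).trace = ∑ i, ∑ j, (x i * κ i * β i j + x j * κ j * β j i) ^ 2 := by
    simp only [Matrix.trace, Matrix.diag_apply, Matrix.mul_apply, hSe]
    exact Finset.sum_congr rfl fun i _ => Finset.sum_congr rfl fun j _ => by ring
  have key := trace_sq_le_of_hessForm_nonneg (β := β) hA hx0 hκ1
  have hfin : S.trace ^ 2 ≤ 2 * (S.trace ^ 2 - (S * S).trace + 2 * R.trace) := by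
    rw [hSS, hStr]
    nlinarith
  have e0 : p.eval 0 = T.det ^ 2 := by rw [hdet]; simp
  have e1 : p.derivative.eval 0 = T.det ^ 2 * S.trace := by rw [hd1]; simp
  rw [e0, e1, hd2]
  nlinarith [mul_le_mul_of_nonneg_left hfin (sq_nonneg (T.det ^ 2))]

/-- The ratio of the two determinants is `∏ (1 + λᵢ²)`, which exceeds every `λᵢ²`. A bound on the
area density therefore bounds the map. -/
theorem det_gram_mul_norm_map_sq_le (hV : Module.finrank ℝ V = m) (A : V →ₗ[ℝ] W) (c : Fin m → V)
    (u : V) : (Matrix.gram ℝ c).det * ‖A u‖ ^ 2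
      ≤ (inducedMetric (Matrix.gram ℝ c) fun i => A (c i)).det * ‖u‖ ^ 2 := by
  obtain ⟨o, hAA⟩ := exists_orthonormalBasis_inner_map hV A
  set T : Matrix (Fin m) (Fin m) ℝ := Matrix.of fun j i => inner ℝ (o j) (c i) with hT
  have hcT : ∀ i, c i = ∑ j, T j i • o j := fun i => (o.sum_repr' (c i)).symm
  have e1 : Matrix.gram ℝ c = T.transpose * Matrix.gram ℝ o * T := by
    have := crossGram_changeFrame T o o
    rw [← funext hcT] at this
    exact this
  have e2 : (fun i => A (c i)) = fun i => ∑ j, T j i • A (o j) := by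
    funext i
    conv_lhs => rw [hcT i]
    simp only [map_sum, map_smul]
  have ho : Matrix.gram ℝ o = 1 := Matrix.gram_eq_one_iff_orthonormal.2 o.orthonormal
  have hdiag : inducedMetric (Matrix.gram ℝ o) (fun i => A (o i))
      = Matrix.diagonal fun i : Fin m => 1 + A.singularValues i ^ 2 := by
    ext i j
    simp only [inducedMetric, crossGram, Matrix.add_apply, ho, Matrix.of_apply, hAA,
      Matrix.diagonal_apply, Matrix.one_apply]
    split_ifs <;> simp
  have hle := norm_map_sq_le_of_singularValues_le hV (A := A)
    (R := ∏ i : Fin m, (1 + A.singularValues i ^ 2)) (fun i => by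
      rw [← Finset.mul_prod_erase _ _ (Finset.mem_univ i)]
      have h1 : 1 ≤ ∏ j ∈ Finset.univ.erase i, (1 + A.singularValues (j : Fin m) ^ 2) :=
        Finset.prod_const_one.symm.trans_le (Finset.prod_le_prod (fun _ _ => zero_le_one)
          fun j _ => by nlinarith [sq_nonneg (A.singularValues j)])
      nlinarith [sq_nonneg (A.singularValues i)]) u
  rw [e1, e2, inducedMetric_changeFrame, hdiag, ho]
  simp only [Matrix.det_mul, Matrix.det_transpose, Matrix.det_one, Matrix.det_diagonal]
  nlinarith [mul_le_mul_of_nonneg_left hle (sq_nonneg T.det)]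

/-- Monotonicity of the first variation of the area between two linear maps with singular values
in `C`, together with the case of equality. -/
theorem firstVariation_gap {C : Set (Fin m → ℝ)} (hCs : IsSymmetric C) (hCc : Convex ℝ C)
    (hCM : C ⊆ closure (setM m)) (hV : Module.finrank ℝ V = m) {A₀ A₁ : V →ₗ[ℝ] W}
    (h₀ : (fun i : Fin m => A₀.singularValues i) ∈ C)
    (h₁ : (fun i : Fin m => A₁.singularValues i) ∈ C) {c : Fin m → V}
    (hc : LinearIndependent ℝ c) :
    firstVariation (Matrix.gram ℝ c) (fun i => A₀ (c i)) (fun i => (A₁ - A₀) (c i))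
      ≤ firstVariation (Matrix.gram ℝ c) (fun i => A₁ (c i)) (fun i => (A₁ - A₀) (c i)) ∧
    (firstVariation (Matrix.gram ℝ c) (fun i => A₀ (c i)) (fun i => (A₁ - A₀) (c i))
      = firstVariation (Matrix.gram ℝ c) (fun i => A₁ (c i)) (fun i => (A₁ - A₀) (c i)) →
      A₀ = A₁) := by
  set g := Matrix.gram ℝ c with hg
  have hgp : g.PosDef := Matrix.posDef_gram_of_linearIndependent hc
  set P : Fin m → W := fun i => A₀ (c i) with hP
  set Q : Fin m → W := fun i => (A₁ - A₀) (c i) with hQ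
  obtain ⟨p, hp⟩ := exists_polynomial_det_inducedMetric g P Q
  have hP1 : (fun i => A₁ (c i)) = P + (1 : ℝ) • Q := by
    funext i; simp [hP, hQ]
  have hP0 : P = P + (0 : ℝ) • Q := by simp
  have hfv : ∀ t : ℝ, firstVariation g (P + t • Q) Q = p.derivative.eval t / (2 * √(p.eval t)) := by
    intro t
    have h1 := (hasDerivAt_det_inducedMetric g P Q t).congr_deriv rfl
    simp only [hp] at h1
    rw [firstVariation, hp t, h1.unique (p.hasDerivAt t)]
  have hpos : ∀ t, 0 < p.eval t := fun t => by rw [← hp]; exact det_inducedMetric_pos hgp _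
  have hlin : ∀ (t : ℝ) (i : Fin m), (P + t • Q) i = (A₀ + t • (A₁ - A₀)) (c i) := fun t i => by
    simp [hP, hQ]
  have hconv : ∀ t ∈ Icc (0 : ℝ) 1, p.derivative.eval t ^ 2
      ≤ 2 * p.eval t * p.derivative.derivative.eval t := by
    intro t ht
    have h := sq_deriv_le_of_hessForm_nonneg hV (A₀ + t • (A₁ - A₀)) (A₁ - A₀)
      (hessForm_singularValues_nonneg hCs hCc hCM hV h₀ h₁ ht) c
      -- Shifting the parameter by `t` moves the inequality, available at parameter `0`, to an
      -- arbitrary point of the segment.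
      (p := p.comp (Polynomial.X + Polynomial.C t)) (fun s => by
        rw [Polynomial.eval_comp, Polynomial.eval_add, Polynomial.eval_X, Polynomial.eval_C,
          ← hp (s + t)]
        congr 2
        funext i
        rw [hlin]
        simp only [Pi.add_apply, Pi.smul_apply, LinearMap.add_apply, LinearMap.smul_apply]
        module)
    simpa [Polynomial.derivative_comp, Polynomial.eval_comp] using h
  obtain ⟨hle, heq⟩ := slope_sqrt_polynomial hpos hconv
  rw [hP1]
  have e0 := hfv 0
  rw [← hP0] at e0
  rw [e0, hfv 1]
  refine ⟨hle, fun h => ?_⟩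
  have hconst := heq h
  have hgd := hgp.det_pos
  ext u
  by_contra hne
  have hB : 0 < ‖(A₁ - A₀) u‖ := norm_pos_iff.2 (by
    rw [LinearMap.sub_apply]; exact sub_ne_zero.2 (Ne.symm hne))
  set K := p.eval 0 * ‖u‖ ^ 2 / g.det with hK
  -- The density is constant on the entire line, so the affine curve `A₀ u + t (A₁ - A₀) u` is
  -- bounded and its velocity must vanish.
  have hbd : ∀ t : ℝ, ‖A₀ u + t • (A₁ - A₀) u‖ ^ 2 ≤ K := by
    intro t
    have h := det_gram_mul_norm_map_sq_le hV (A₀ + t • (A₁ - A₀)) c u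
    have e : (fun i => (A₀ + t • (A₁ - A₀)) (c i)) = P + t • Q := funext fun i => (hlin t i).symm
    rw [e, ← hg, hp, hconst] at h
    rw [hK, le_div_iff₀ hgd, mul_comm]
    exact h
  have hbd' : ∀ t : ℝ, 0 ≤ t → t * ‖(A₁ - A₀) u‖ ≤ √K + ‖A₀ u‖ := by
    intro t ht
    have h1 : ‖A₀ u + t • (A₁ - A₀) u‖ ≤ √K := Real.le_sqrt_of_sq_le (hbd t)
    have h2 : ‖t • (A₁ - A₀) u‖ ≤ ‖A₀ u + t • (A₁ - A₀) u‖ + ‖A₀ u‖ := by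
      have := norm_sub_le (A₀ u + t • (A₁ - A₀) u) (A₀ u)
      simpa using this
    rw [norm_smul, Real.norm_eq_abs, abs_of_nonneg ht] at h2
    linarith
  have h3 := hbd' ((√K + ‖A₀ u‖ + 1) / ‖(A₁ - A₀) u‖) (by positivity)
  rw [div_mul_cancel₀ _ hB.ne'] at h3
  linarith

end Convexity

/-! ### Metric and first variation in charts, and change of chart. -/

section Charts

variable {m n : ℕ} {M : Type*} [TopologicalSpace M]

/-- The partial derivatives of a map on `ℝᵐ`. -/
def partials {W : Type*} [NormedAddCommGroup W] [NormedSpace ℝ W]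
    (h : EuclideanSpace ℝ (Fin m) → W) (y : EuclideanSpace ℝ (Fin m)) : Fin m → W :=
  fun i => fderiv ℝ h y (EuclideanSpace.single i 1)

/-- The Jacobian matrix of the transition map between the charts `e` and `e'`. -/
def transitionMatrix (e e' : OpenPartialHomeomorph M (EuclideanSpace ℝ (Fin m)))
    (y : EuclideanSpace ℝ (Fin m)) : Matrix (Fin m) (Fin m) ℝ :=
  LinearMap.toMatrix (EuclideanSpace.basisFun (Fin m) ℝ).toBasis
    (EuclideanSpace.basisFun (Fin m) ℝ).toBasis
    (fderiv ℝ (fun z => e' (e.symm z)) y).toLinearMap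

theorem eventuallyEq_symm_transition {e e' : OpenPartialHomeomorph M (EuclideanSpace ℝ (Fin m))}
    {y : EuclideanSpace ℝ (Fin m)} (hy : y ∈ e.target) (hy' : e.symm y ∈ e'.source) :
    e.symm =ᶠ[nhds y] fun z => e'.symm (e' (e.symm z)) := by
  have h := (e.continuousAt_symm hy).eventually (e'.open_source.mem_nhds hy')
  filter_upwards [h] with z hz
  exact (e'.left_inv hz).symm

theorem fderiv_transition_single (e e' : OpenPartialHomeomorph M (EuclideanSpace ℝ (Fin m)))
    (y : EuclideanSpace ℝ (Fin m)) (i : Fin m) :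
    fderiv ℝ (fun z => e' (e.symm z)) y (EuclideanSpace.single i 1)
      = ∑ j, transitionMatrix e e' y j i • EuclideanSpace.single j (1 : ℝ) := by
  have h := (EuclideanSpace.basisFun (Fin m) ℝ).toBasis.sum_repr
    (fderiv ℝ (fun z => e' (e.symm z)) y (EuclideanSpace.single i 1))
  rw [← h]
  refine Finset.sum_congr rfl fun j _ => ?_
  simp [transitionMatrix, LinearMap.toMatrix_apply]

theorem det_transitionMatrix (e e' : OpenPartialHomeomorph M (EuclideanSpace ℝ (Fin m)))
    (y : EuclideanSpace ℝ (Fin m)) :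
    (transitionMatrix e e' y).det = (fderiv ℝ (fun z => e' (e.symm z)) y).det := by
  rw [transitionMatrix, LinearMap.det_toMatrix]

variable [ChartedSpace (EuclideanSpace ℝ (Fin m)) M]

/-- The coordinate vector fields of the chart `e`. -/
def chartFrame (e : OpenPartialHomeomorph M (EuclideanSpace ℝ (Fin m)))
    (y : EuclideanSpace ℝ (Fin m)) : Fin m → TangentSpace (𝓡 m) (e.symm y) :=
  fun i => mfderiv (𝓡 m) (𝓡 m) e.symm y (EuclideanSpace.single i (1 : ℝ))

theorem linearIndependent_chartFrame [IsManifold (𝓡 m) ∞ M]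
    {e : OpenPartialHomeomorph M (EuclideanSpace ℝ (Fin m))}
    (he : e ∈ atlas (EuclideanSpace ℝ (Fin m)) M) {y : EuclideanSpace ℝ (Fin m)}
    (hy : y ∈ e.target) : LinearIndependent ℝ (chartFrame e y) := by
  have : IsManifold (𝓡 m) 1 M := IsManifold.of_le (n := ∞) (by norm_num)
  have hb := (EuclideanSpace.basisFun (Fin m) ℝ).toBasis.linearIndependent
  have hinj := ((mdifferentiable_of_mem_atlas (I := 𝓡 m) he).symm).mfderiv_injective hy
  have h := hb.map' (mfderiv (𝓡 m) (𝓡 m) e.symm y).toLinearMap (LinearMap.ker_eq_bot.2 hinj)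
  have hc : chartFrame e y = (mfderiv (𝓡 m) (𝓡 m) e.symm y).toLinearMap ∘
      (EuclideanSpace.basisFun (Fin m) ℝ).toBasis := by
    funext i
    have hbi : (EuclideanSpace.basisFun (Fin m) ℝ).toBasis i = EuclideanSpace.single i (1 : ℝ) := by
      simp
    change _ = mfderiv (𝓡 m) (𝓡 m) e.symm y ((EuclideanSpace.basisFun (Fin m) ℝ).toBasis i)
    rw [hbi]
    rfl
  rw [hc]
  exact h

theorem partials_comp_symm [IsManifold (𝓡 m) ∞ M]
    {e : OpenPartialHomeomorph M (EuclideanSpace ℝ (Fin m))}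
    (he : e ∈ atlas (EuclideanSpace ℝ (Fin m)) M) {f : M → EuclideanSpace ℝ (Fin n)}
    {y : EuclideanSpace ℝ (Fin m)} (hy : y ∈ e.target)
    (hf : MDifferentiableAt (𝓡 m) (𝓡 n) f (e.symm y)) :
    partials (fun z => f (e.symm z)) y
      = fun i => mfderiv (𝓡 m) (𝓡 n) f (e.symm y) (chartFrame e y i) := by
  have : IsManifold (𝓡 m) 1 M := IsManifold.of_le (n := ∞) (by norm_num)
  funext i
  have h := mfderiv_comp y hf (mdifferentiableAt_atlas_symm he hy)
  rw [partials, ← mfderiv_eq_fderiv]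
  change mfderiv (𝓡 m) (𝓡 n) (f ∘ e.symm) y (EuclideanSpace.single i (1 : ℝ)) = _
  rw [h]
  rfl

theorem differentiableAt_transition [IsManifold (𝓡 m) ∞ M]
    {e e' : OpenPartialHomeomorph M (EuclideanSpace ℝ (Fin m))}
    (he : e ∈ atlas (EuclideanSpace ℝ (Fin m)) M) (he' : e' ∈ atlas (EuclideanSpace ℝ (Fin m)) M)
    {y : EuclideanSpace ℝ (Fin m)} (hy : y ∈ e.target) (hy' : e.symm y ∈ e'.source) :
    DifferentiableAt ℝ (fun z => e' (e.symm z)) y := by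
  have : IsManifold (𝓡 m) 1 M := IsManifold.of_le (n := ∞) (by norm_num)
  exact mdifferentiableAt_iff_differentiableAt.1
    ((mdifferentiableAt_atlas he' hy').comp y (mdifferentiableAt_atlas_symm he hy))

theorem partials_transition [IsManifold (𝓡 m) ∞ M]
    {e e' : OpenPartialHomeomorph M (EuclideanSpace ℝ (Fin m))}
    (he : e ∈ atlas (EuclideanSpace ℝ (Fin m)) M) (he' : e' ∈ atlas (EuclideanSpace ℝ (Fin m)) M)
    {y : EuclideanSpace ℝ (Fin m)} (hy : y ∈ e.target) (hy' : e.symm y ∈ e'.source)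
    {f : M → EuclideanSpace ℝ (Fin n)} (hf : MDifferentiableAt (𝓡 m) (𝓡 n) f (e.symm y)) :
    partials (fun z => f (e.symm z)) y = fun i => ∑ j, transitionMatrix e e' y j i •
      partials (fun z => f (e'.symm z)) (e' (e.symm y)) j := by
  have : IsManifold (𝓡 m) 1 M := IsManifold.of_le (n := ∞) (by norm_num)
  funext i
  have hev : (fun z => f (e.symm z)) =ᶠ[nhds y]
      (fun z => f (e'.symm z)) ∘ fun z => e' (e.symm z) := by
    filter_upwards [eventuallyEq_symm_transition hy hy'] with z hz
    simp only [Function.comp_apply]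
    rw [← hz]
  have hd : DifferentiableAt ℝ (fun z => f (e'.symm z)) (e' (e.symm y)) := by
    refine mdifferentiableAt_iff_differentiableAt.1 (MDifferentiableAt.comp (e' (e.symm y))
      (I' := 𝓡 m) ?_ (mdifferentiableAt_atlas_symm he' (e'.map_source hy')))
    rwa [e'.left_inv hy']
  rw [partials, hev.fderiv_eq, fderiv_comp y hd (differentiableAt_transition he he' hy hy'),
    ContinuousLinearMap.comp_apply, fderiv_transition_single]
  simp [partials]

theorem chartFrame_transition [IsManifold (𝓡 m) ∞ M]
    {e e' : OpenPartialHomeomorph M (EuclideanSpace ℝ (Fin m))}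
    (he : e ∈ atlas (EuclideanSpace ℝ (Fin m)) M) (he' : e' ∈ atlas (EuclideanSpace ℝ (Fin m)) M)
    {y : EuclideanSpace ℝ (Fin m)} (hy : y ∈ e.target) (hy' : e.symm y ∈ e'.source) (i : Fin m) :
    (chartFrame e y i : EuclideanSpace ℝ (Fin m))
      = ∑ j, transitionMatrix e e' y j i •
        (chartFrame e' (e' (e.symm y)) j : EuclideanSpace ℝ (Fin m)) := by
  have : IsManifold (𝓡 m) 1 M := IsManifold.of_le (n := ∞) (by norm_num)
  have h1 := (eventuallyEq_symm_transition hy hy').mfderiv_eq (I := 𝓡 m) (I' := 𝓡 m)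
  have h2 := mfderiv_comp (I := 𝓡 m) (I' := 𝓡 m) (I'' := 𝓡 m) y
    (mdifferentiableAt_atlas_symm he' (e'.map_source hy'))
    (differentiableAt_transition he he' hy hy').mdifferentiableAt
  have h3 : mfderiv (𝓡 m) (𝓡 m) e.symm y = (mfderiv (𝓡 m) (𝓡 m) e'.symm (e' (e.symm y))).comp
      (mfderiv (𝓡 m) (𝓡 m) (fun z => e' (e.symm z)) y) := h1.trans h2
  have h4 : chartFrame e y i = mfderiv (𝓡 m) (𝓡 m) e'.symm (e' (e.symm y))
      (fderiv ℝ (fun z => e' (e.symm z)) y (EuclideanSpace.single i (1 : ℝ))) := by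
    rw [chartFrame, h3, mfderiv_eq_fderiv]
    rfl
  rw [h4, fderiv_transition_single]
  exact (map_sum (mfderiv (𝓡 m) (𝓡 m) e'.symm (e' (e.symm y))) _ _).trans
    (Finset.sum_congr rfl fun j _ => map_smul _ _ _)

variable [RiemannianBundle (fun x : M ↦ TangentSpace (𝓡 m) x)]

/-- The coefficients of the Riemannian metric in the chart `e`. -/
def metricMatrix (e : OpenPartialHomeomorph M (EuclideanSpace ℝ (Fin m)))
    (y : EuclideanSpace ℝ (Fin m)) : Matrix (Fin m) (Fin m) ℝ :=
  Matrix.gram ℝ (E := TangentSpace (𝓡 m) (e.symm y)) (chartFrame e y)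

theorem gramMatrix_graph (e : OpenPartialHomeomorph M (EuclideanSpace ℝ (Fin m)))
    (f : M → EuclideanSpace ℝ (Fin n)) (y : EuclideanSpace ℝ (Fin m)) :
    gramMatrix e (fun x => (x, f x)) y
      = inducedMetric (metricMatrix e y) (partials (fun z => f (e.symm z)) y) :=
  rfl

theorem posDef_metricMatrix [IsManifold (𝓡 m) ∞ M]
    {e : OpenPartialHomeomorph M (EuclideanSpace ℝ (Fin m))}
    (he : e ∈ atlas (EuclideanSpace ℝ (Fin m)) M) {y : EuclideanSpace ℝ (Fin m)}
    (hy : y ∈ e.target) : (metricMatrix e y).PosDef :=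
  Matrix.posDef_gram_of_linearIndependent (linearIndependent_chartFrame he hy)

theorem contDiffOn_metricMatrix [IsManifold (𝓡 m) ∞ M]
    [IsContMDiffRiemannianBundle (𝓡 m) ∞ (EuclideanSpace ℝ (Fin m))
      (fun x : M ↦ TangentSpace (𝓡 m) x)]
    {e : OpenPartialHomeomorph M (EuclideanSpace ℝ (Fin m))}
    (he : e ∈ atlas (EuclideanSpace ℝ (Fin m)) M) (i j : Fin m) :
    ContDiffOn ℝ ∞ (fun y => metricMatrix e y i j) e.target := by
  have hs : ContMDiffOn (𝓡 m) (𝓡 m) ∞ e.symm e.target :=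
    contMDiffOn_symm_of_mem_maximalAtlas (IsManifold.subset_maximalAtlas he)
  have hT := hs.contMDiffOn_tangentMapWithin (m := ∞) (by norm_num) e.open_target.uniqueMDiffOn
  have hfr : ∀ i : Fin m, ContMDiffOn (𝓡 m) (𝓡 m).tangent ∞
      (fun y => (⟨e.symm y, chartFrame e y i⟩ : TangentBundle (𝓡 m) M)) e.target := by
    intro i
    have hv : ContMDiffOn (𝓡 m) (𝓡 m).tangent ∞
        (fun y : EuclideanSpace ℝ (Fin m) =>
          (⟨y, EuclideanSpace.single i 1⟩ : TangentBundle (𝓡 m) (EuclideanSpace ℝ (Fin m))))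
        e.target :=
      contMDiffOn_vectorSpace_iff_contDiffOn.2 contDiffOn_const
    refine (hT.comp hv fun y hy => hy).congr fun y hy => ?_
    simp only [Function.comp_apply, tangentMapWithin, chartFrame]
    rw [mfderivWithin_of_isOpen e.open_target hy]
  have h := (hfr i).inner_bundle (hfr j)
  exact contMDiffOn_iff_contDiffOn.1 h

theorem continuousOn_metricMatrix [IsManifold (𝓡 m) ∞ M]
    [IsContMDiffRiemannianBundle (𝓡 m) ∞ (EuclideanSpace ℝ (Fin m))
      (fun x : M ↦ TangentSpace (𝓡 m) x)]
    {e : OpenPartialHomeomorph M (EuclideanSpace ℝ (Fin m))}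
    (he : e ∈ atlas (EuclideanSpace ℝ (Fin m)) M) :
    ContinuousOn (metricMatrix e) e.target :=
  continuousOn_pi.2 fun i => continuousOn_pi.2 fun j => (contDiffOn_metricMatrix he i j).continuousOn

theorem metricMatrix_transition [IsManifold (𝓡 m) ∞ M]
    {e e' : OpenPartialHomeomorph M (EuclideanSpace ℝ (Fin m))}
    (he : e ∈ atlas (EuclideanSpace ℝ (Fin m)) M) (he' : e' ∈ atlas (EuclideanSpace ℝ (Fin m)) M)
    {y : EuclideanSpace ℝ (Fin m)} (hy : y ∈ e.target) (hy' : e.symm y ∈ e'.source) :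
    metricMatrix e y = (transitionMatrix e e' y).transpose * metricMatrix e' (e' (e.symm y)) *
      transitionMatrix e e' y := by
  -- The two frames live in tangent spaces at points that are equal only propositionally; both
  -- spaces are the model space, and only the inner product has to be transported.
  have key : ∀ (x x' : M), x = x' → ∀ u v : EuclideanSpace ℝ (Fin m),
      inner ℝ (E := TangentSpace (𝓡 m) x) u v = inner ℝ (E := TangentSpace (𝓡 m) x') u v := by
    rintro x _ rfl u v; rfl
  refine Eq.trans ?_ (crossGram_changeFrame (W := TangentSpace (𝓡 m) (e'.symm (e' (e.symm y))))
    (transitionMatrix e e' y) (chartFrame e' (e' (e.symm y))) (chartFrame e' (e' (e.symm y))))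
  ext i j
  refine (key _ _ (e'.left_inv hy').symm _ _).trans ?_
  rw [chartFrame_transition he he' hy hy' i, chartFrame_transition he he' hy hy' j]
  rfl

/-- The density, in the chart `e`, of the first variation of the area of the graph of `f` in the
direction `ψ`. -/
def variationDensity (e : OpenPartialHomeomorph M (EuclideanSpace ℝ (Fin m)))
    (f ψ : M → EuclideanSpace ℝ (Fin n)) (y : EuclideanSpace ℝ (Fin m)) : ℝ :=
  firstVariation (metricMatrix e y) (partials (fun z => f (e.symm z)) y)
    (partials (fun z => ψ (e.symm z)) y)

theorem variationDensity_transition [IsManifold (𝓡 m) ∞ M]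
    {e e' : OpenPartialHomeomorph M (EuclideanSpace ℝ (Fin m))}
    (he : e ∈ atlas (EuclideanSpace ℝ (Fin m)) M) (he' : e' ∈ atlas (EuclideanSpace ℝ (Fin m)) M)
    {y : EuclideanSpace ℝ (Fin m)} (hy : y ∈ e.target) (hy' : e.symm y ∈ e'.source)
    {f ψ : M → EuclideanSpace ℝ (Fin n)} (hf : MDifferentiableAt (𝓡 m) (𝓡 n) f (e.symm y))
    (hψ : MDifferentiableAt (𝓡 m) (𝓡 n) ψ (e.symm y)) :
    variationDensity e f ψ y = |(fderiv ℝ (fun z => e' (e.symm z)) y).det| *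
      variationDensity e' f ψ (e' (e.symm y)) := by
  have hdet : (transitionMatrix e e' y).det ≠ 0 := by
    intro h0
    have := (posDef_metricMatrix he hy).det_pos
    rw [metricMatrix_transition he he' hy hy', Matrix.det_mul, h0] at this
    simp at this
  rw [variationDensity, metricMatrix_transition he he' hy hy',
    partials_transition he he' hy hy' hf, partials_transition he he' hy hy' hψ,
    firstVariation_changeFrame hdet, det_transitionMatrix]
  rfl

theorem integral_variationDensity_transition [IsManifold (𝓡 m) ∞ M]
    {e e' : OpenPartialHomeomorph M (EuclideanSpace ℝ (Fin m))}
    (he : e ∈ atlas (EuclideanSpace ℝ (Fin m)) M) (he' : e' ∈ atlas (EuclideanSpace ℝ (Fin m)) M)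
    {S : Set M} (hS : IsOpen S) (hSe : S ⊆ e.source) (hSe' : S ⊆ e'.source)
    {f ψ : M → EuclideanSpace ℝ (Fin n)} (hf : ∀ x ∈ S, MDifferentiableAt (𝓡 m) (𝓡 n) f x)
    (hψ : ∀ x ∈ S, MDifferentiableAt (𝓡 m) (𝓡 n) ψ x) (ρ : M → ℝ) :
    ∫ y in e '' S, ρ (e.symm y) * variationDensity e f ψ y
      = ∫ y in e' '' S, ρ (e'.symm y) * variationDensity e' f ψ y := by
  have himg : e' '' S = (fun z => e' (e.symm z)) '' (e '' S) := by
    rw [image_image]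
    exact image_congr fun x hx => by rw [e.left_inv (hSe hx)]
  have hmeas : MeasurableSet (e '' S) := (e.isOpen_image_of_subset_source hS hSe).measurableSet
  have hinj : InjOn (fun z => e' (e.symm z)) (e '' S) := by
    rintro _ ⟨x, hx, rfl⟩ _ ⟨x', hx', rfl⟩ h
    simp only [e.left_inv (hSe hx), e.left_inv (hSe hx')] at h
    rw [e'.injOn (hSe' hx) (hSe' hx') h]
  rw [himg, integral_image_eq_integral_abs_det_fderiv_smul volume hmeas (f' := fun y =>
    fderiv ℝ (fun z => e' (e.symm z)) y) ?_ hinj]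
  · refine setIntegral_congr_fun hmeas ?_
    rintro _ ⟨x, hx, rfl⟩
    have h1 : e x ∈ e.target := e.map_source (hSe hx)
    have h2 : e.symm (e x) = x := e.left_inv (hSe hx)
    have h3 : e.symm (e x) ∈ e'.source := by rw [h2]; exact hSe' hx
    simp only [smul_eq_mul]
    rw [variationDensity_transition he he' h1 h3 (by rw [h2]; exact hf x hx)
      (by rw [h2]; exact hψ x hx), h2, e'.left_inv (hSe' hx)]
    ring
  · rintro _ ⟨x, hx, rfl⟩
    exact (differentiableAt_transition he he' (e.map_source (hSe hx))
      (by rw [e.left_inv (hSe hx)]; exact hSe' hx)).hasFDerivAt.hasFDerivWithinAt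

end Charts

/-! ### From stationarity of the area to the weak system in one chart. -/

section Stationary

variable {m n : ℕ} {M : Type*} [TopologicalSpace M] [ChartedSpace (EuclideanSpace ℝ (Fin m)) M]

theorem contDiffOn_comp_symm [IsManifold (𝓡 m) ∞ M]
    {e : OpenPartialHomeomorph M (EuclideanSpace ℝ (Fin m))}
    (he : e ∈ atlas (EuclideanSpace ℝ (Fin m)) M) {D : Set M} {f : M → EuclideanSpace ℝ (Fin n)}
    (hf : ContMDiffOn (𝓡 m) (𝓡 n) ∞ f D) :
    ContDiffOn ℝ ∞ (fun z => f (e.symm z)) (e.target ∩ e.symm ⁻¹' D) := by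
  have hs : ContMDiffOn (𝓡 m) (𝓡 m) ∞ e.symm e.target :=
    contMDiffOn_symm_of_mem_maximalAtlas (IsManifold.subset_maximalAtlas he)
  exact contMDiffOn_iff_contDiffOn.1
    (hf.comp (hs.mono inter_subset_left) fun y hy => hy.2)

theorem continuousOn_partials {W : Type*} [NormedAddCommGroup W] [NormedSpace ℝ W]
    {U : Set (EuclideanSpace ℝ (Fin m))} (hU : IsOpen U) {h : EuclideanSpace ℝ (Fin m) → W}
    (hh : ContDiffOn ℝ ∞ h U) : ContinuousOn (partials h) U :=
  continuousOn_pi.2 fun _ =>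
    (hh.continuousOn_fderiv_of_isOpen hU (by norm_num)).clm_apply continuousOn_const

theorem contMDiffAt_of_mem {D : Set M} (hD : IsOpen D) {f : M → EuclideanSpace ℝ (Fin n)}
    (hf : ContMDiffOn (𝓡 m) (𝓡 n) ∞ f D) {x : M} (hx : x ∈ D) :
    MDifferentiableAt (𝓡 m) (𝓡 n) f x :=
  (hf.contMDiffAt (hD.mem_nhds hx)).mdifferentiableAt (by norm_num)

theorem isGraphVariation_add_smul {D : Set M} {f ψ : M → EuclideanSpace ℝ (Fin n)}
    (hf : ContMDiffOn (𝓡 m) (𝓡 n) ∞ f D) (hψ : ContMDiffOn (𝓡 m) (𝓡 n) ∞ ψ D) {K : Set M}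
    (hK : IsCompact K) (hKD : K ⊆ D) (h0 : ∀ x ∈ D \ K, ψ x = 0) :
    IsGraphVariation m D f K 1 (fun t x => (x, f x + t • ψ x)) where
  isCompact := hK
  subset := hKD
  pos := one_pos
  contMDiffOn := by
    have h2 : ContMDiffOn (𝓘(ℝ, ℝ).prod (𝓡 m)) (𝓡 m) ∞ (fun p : ℝ × M => p.2)
        (Ioo (-1) 1 ×ˢ D) := contMDiffOn_snd
    have h1 : ContMDiffOn (𝓘(ℝ, ℝ).prod (𝓡 m)) 𝓘(ℝ, ℝ) ∞ (fun p : ℝ × M => p.1)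
        (Ioo (-1) 1 ×ˢ D) := contMDiffOn_fst
    exact h2.prodMk ((hf.comp h2 fun p hp => hp.2).add (h1.smul (hψ.comp h2 fun p hp => hp.2)))
  zero := by simp
  eq_off := by
    intro t _ x hx
    simp [h0 x hx]

variable [RiemannianBundle (fun x : M ↦ TangentSpace (𝓡 m) x)]

theorem continuousOn_variationDensity [IsManifold (𝓡 m) ∞ M]
    [IsContMDiffRiemannianBundle (𝓡 m) ∞ (EuclideanSpace ℝ (Fin m))
      (fun x : M ↦ TangentSpace (𝓡 m) x)]
    {e : OpenPartialHomeomorph M (EuclideanSpace ℝ (Fin m))}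
    (he : e ∈ atlas (EuclideanSpace ℝ (Fin m)) M) {D : Set M} (hD : IsOpen D)
    {f ψ : M → EuclideanSpace ℝ (Fin n)} (hf : ContMDiffOn (𝓡 m) (𝓡 n) ∞ f D)
    (hψ : ContMDiffOn (𝓡 m) (𝓡 n) ∞ ψ D) :
    ContinuousOn (variationDensity e f ψ) (e.target ∩ e.symm ⁻¹' D) :=
  continuousOn_firstVariation ((continuousOn_metricMatrix he).mono inter_subset_left)
    (continuousOn_partials (e.isOpen_inter_preimage_symm hD) (contDiffOn_comp_symm he hf))
    (continuousOn_partials (e.isOpen_inter_preimage_symm hD) (contDiffOn_comp_symm he hψ))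
    fun _ hy => posDef_metricMatrix he hy.1

theorem variationDensity_eq_zero {e : OpenPartialHomeomorph M (EuclideanSpace ℝ (Fin m))}
    {f ψ : M → EuclideanSpace ℝ (Fin n)} {S : Set M} (hS : IsOpen S) (hψ : ∀ x ∈ S, ψ x = 0)
    {y : EuclideanSpace ℝ (Fin m)} (hy : y ∈ e.target) (hyS : e.symm y ∈ S) :
    variationDensity e f ψ y = 0 := by
  have hev : (fun z => ψ (e.symm z)) =ᶠ[nhds y] fun _ => 0 := by
    filter_upwards [(e.continuousAt_symm hy).eventually (hS.mem_nhds hyS)] with z hz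
    exact hψ _ hz
  have h0 : partials (fun z => ψ (e.symm z)) y = (0 : ℝ) • 0 := by
    funext i
    simp [partials, hev.fderiv_eq]
  rw [variationDensity, h0, firstVariation_smul, zero_mul]

/-- The weak form of the minimal surface system, in a chart. -/
theorem IsMinimalMapOn.integral_variationDensity [T2Space M] [IsManifold (𝓡 m) ∞ M]
    [IsContMDiffRiemannianBundle (𝓡 m) ∞ (EuclideanSpace ℝ (Fin m))
      (fun x : M ↦ TangentSpace (𝓡 m) x)] {D : Set M} (hD : IsOpen D)
    {f ψ : M → EuclideanSpace ℝ (Fin n)} (hf : IsMinimalMapOn m f D)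
    {e : OpenPartialHomeomorph M (EuclideanSpace ℝ (Fin m))}
    (he : e ∈ atlas (EuclideanSpace ℝ (Fin m)) M)
    (hψ : ContMDiffOn (𝓡 m) (𝓡 n) ∞ ψ D) {K : Set M} (hK : IsCompact K) (hKD : K ⊆ D)
    (hKe : K ⊆ e.source) (h0 : ∀ x ∈ D \ K, ψ x = 0) :
    ∫ y in e.target ∩ e.symm ⁻¹' D, variationDensity e f ψ y = 0 := by
  have hU : IsOpen (e.target ∩ e.symm ⁻¹' D) := e.isOpen_inter_preimage_symm hD
  have hKc : IsCompact (e '' K) := hK.image_of_continuousOn (e.continuousOn.mono hKe)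
  have hKU : e '' K ⊆ e.target ∩ e.symm ⁻¹' D := by
    rintro _ ⟨x, hx, rfl⟩
    refine ⟨e.map_source (hKe hx), ?_⟩
    rw [mem_preimage, e.left_inv (hKe hx)]
    exact hKD hx
  have hfU := contDiffOn_comp_symm he hf.contMDiffOn
  have hψU := contDiffOn_comp_symm he hψ
  have hgc : ContinuousOn (metricMatrix e) (e '' K) :=
    (continuousOn_metricMatrix he).mono fun y hy => (hKU hy).1
  have hPc := (continuousOn_partials hU hfU).mono hKU
  have hQc := (continuousOn_partials hU hψU).mono hKU
  set g := metricMatrix e with hg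
  set P := partials fun z => f (e.symm z) with hP
  set Q := partials fun z => ψ (e.symm z) with hQ
  have hpos : ∀ y ∈ e '' K, (g y).PosDef := fun y hy => posDef_metricMatrix he (hKU hy).1
  have hPt : ContinuousOn (fun q : ℝ × EuclideanSpace ℝ (Fin m) => P q.2 + q.1 • Q q.2)
      (univ ×ˢ (e '' K)) :=
    (hPc.comp continuousOn_snd fun q hq => hq.2).add
      (continuousOn_fst.smul (hQc.comp continuousOn_snd fun q hq => hq.2))
  have hF'c : ContinuousOn (fun q : ℝ × EuclideanSpace ℝ (Fin m) =>
      firstVariation (g q.2) (P q.2 + q.1 • Q q.2) (Q q.2)) (univ ×ˢ (e '' K)) :=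
    continuousOn_firstVariation (hgc.comp continuousOn_snd fun q hq => hq.2) hPt
      (hQc.comp continuousOn_snd fun q hq => hq.2) fun q hq => hpos q.2 hq.2
  have hFc : ∀ t : ℝ, ContinuousOn (fun y => √(inducedMetric (g y) (P y + t • Q y)).det)
      (e '' K) := by
    intro t
    have hPt' : ContinuousOn (fun y => P y + t • Q y) (e '' K) := hPc.add (hQc.const_smul t)
    have hN : ContinuousOn (fun y => inducedMetric (g y) (P y + t • Q y)) (e '' K) :=
      hgc.add (continuousOn_crossGram hPt' hPt')
    exact ((Continuous.matrix_det continuous_id).comp_continuousOn hN).sqrt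
  -- A bound for the derivative of the density, uniform in `t ∈ [-1, 1]` and `y ∈ e '' K`, permits
  -- differentiation under the integral.
  obtain ⟨B, hB⟩ := ((isCompact_Icc (a := (-1 : ℝ)) (b := 1)).prod hKc).exists_bound_of_continuousOn
    (hF'c.mono (prod_mono (subset_univ _) Subset.rfl))
  have hder := (hasDerivAt_integral_of_dominated_loc_of_deriv_le
    (μ := volume.restrict (e '' K)) (x₀ := (0 : ℝ)) (s := Ioo (-1) 1) (bound := fun _ => B)
    (F := fun t y => √(inducedMetric (g y) (P y + t • Q y)).det)
    (F' := fun t y => firstVariation (g y) (P y + t • Q y) (Q y))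
    (Ioo_mem_nhds (by norm_num) (by norm_num))
    (Filter.Eventually.of_forall fun t => (hFc t).aestronglyMeasurable hKc.measurableSet)
    ((hFc 0).integrableOn_compact hKc)
    ((hF'c.comp (continuousOn_const.prodMk continuousOn_id)
      fun y hy => ⟨mem_univ _, hy⟩).aestronglyMeasurable hKc.measurableSet)
    ((ae_restrict_iff' hKc.measurableSet).2 (Filter.Eventually.of_forall fun y hy t ht =>
      hB (t, y) ⟨Ioo_subset_Icc_self ht, hy⟩))
    (integrableOn_const hKc.measure_lt_top.ne)
    ((ae_restrict_iff' hKc.measurableSet).2 (Filter.Eventually.of_forall fun y hy t _ =>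
      hasDerivAt_sqrt_det_inducedMetric (hpos y hy) (P y) (Q y) t))).2
  -- Vertical variations `(x, f x + t ψ x)` suffice for the weak system.
  have hst := hf.stationary e he K 1 _
    (isGraphVariation_add_smul hf.contMDiffOn hψ hK hKD h0) hKe
  have harea : ∀ t : ℝ, areaInChart e K (fun x => (x, f x + t • ψ x))
      = ∫ y in e '' K, √(inducedMetric (g y) (P y + t • Q y)).det := by
    intro t
    refine setIntegral_congr_fun hKc.measurableSet fun y hy => ?_
    have hyU := hU.mem_nhds (hKU hy)
    have hpt : partials (fun z => f (e.symm z) + t • ψ (e.symm z)) y = P y + t • Q y := by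
      funext i
      have h1 := (hfU.contDiffAt hyU).differentiableAt (by norm_num)
      have h2 := (hψU.contDiffAt hyU).differentiableAt (by norm_num)
      simp only [partials, hP, hQ, Pi.add_apply, Pi.smul_apply]
      rw [(h1.hasFDerivAt.fun_add (h2.hasFDerivAt.fun_const_smul t)).fderiv]
      rfl
    simp only [gramMatrix_graph e (fun x => f x + t • ψ x) y]
    rw [hpt]
  simp only [harea] at hst
  have hzero := hder.unique hst
  simp only [zero_smul, add_zero] at hzero
  rw [← hzero]
  refine setIntegral_eq_of_subset_of_forall_sdiff_eq_zero hU.measurableSet hKU fun y hy => ?_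
  refine variationDensity_eq_zero (hD.inter hK.isClosed.isOpen_compl) (fun x hx => h0 x hx) hy.1.1
    ⟨hy.1.2, fun hyK => hy.2 ⟨_, hyK, e.right_inv hy.1.1⟩⟩

end Stationary

/-! ### The weak system for test maps not confined to one chart. -/

section Global

variable {m n : ℕ} {M : Type*} [TopologicalSpace M] [ChartedSpace (EuclideanSpace ℝ (Fin m)) M]
  [IsManifold (𝓡 m) ∞ M] [RiemannianBundle (fun x : M ↦ TangentSpace (𝓡 m) x)]
  [IsContMDiffRiemannianBundle (𝓡 m) ∞ (EuclideanSpace ℝ (Fin m))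
    (fun x : M ↦ TangentSpace (𝓡 m) x)]

theorem integrableOn_mul_variationDensity
    {e : OpenPartialHomeomorph M (EuclideanSpace ℝ (Fin m))}
    (he : e ∈ atlas (EuclideanSpace ℝ (Fin m)) M) {D : Set M} (hD : IsOpen D)
    {f ψ : M → EuclideanSpace ℝ (Fin n)} (hf : ContMDiffOn (𝓡 m) (𝓡 n) ∞ f D)
    (hψ : ContMDiffOn (𝓡 m) (𝓡 n) ∞ ψ D) {w : M → ℝ} (hw : Continuous w) {L : Set M}
    (hL : IsCompact L) (hLD : L ⊆ D) (hLe : L ⊆ e.source)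
    (h0 : ∀ y ∈ e.target ∩ e.symm ⁻¹' D, e.symm y ∉ L →
      w (e.symm y) * variationDensity e f ψ y = 0) :
    IntegrableOn (fun y => w (e.symm y) * variationDensity e f ψ y)
      (e.target ∩ e.symm ⁻¹' D) := by
  have hU : IsOpen (e.target ∩ e.symm ⁻¹' D) := e.isOpen_inter_preimage_symm hD
  have hLc : IsCompact (e '' L) := hL.image_of_continuousOn (e.continuousOn.mono hLe)
  have hLU : e '' L ⊆ e.target ∩ e.symm ⁻¹' D := by
    rintro _ ⟨x, hx, rfl⟩
    refine ⟨e.map_source (hLe hx), ?_⟩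
    rw [mem_preimage, e.left_inv (hLe hx)]
    exact hLD hx
  have hc : ContinuousOn (fun y => w (e.symm y) * variationDensity e f ψ y)
      (e.target ∩ e.symm ⁻¹' D) :=
    (hw.comp_continuousOn (e.continuousOn_symm.mono inter_subset_left)).mul
      (continuousOn_variationDensity he hD hf hψ)
  refine ((hc.mono hLU).integrableOn_compact hLc).of_forall_sdiff_eq_zero hU.measurableSet
    fun y hy => h0 y hy.1 fun hyL => hy.2 ⟨_, hyL, e.right_inv hy.1.1⟩

variable [T2Space M]

/-- The weak form of the minimal surface system for test maps with compact support in `D`. -/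
theorem IsMinimalMapOn.sum_integral_variationDensity {D : Set M} (hD : IsOpen D)
    {f φ : M → EuclideanSpace ℝ (Fin n)} (hf : IsMinimalMapOn m f D) {ι : Type*} [Fintype ι]
    {e : ι → OpenPartialHomeomorph M (EuclideanSpace ℝ (Fin m))}
    (he : ∀ a, e a ∈ atlas (EuclideanSpace ℝ (Fin m)) M) {χ : ι → M → ℝ}
    (hχ : ∀ a, ContMDiff (𝓡 m) 𝓘(ℝ, ℝ) ∞ (χ a)) (hsupp : ∀ a, tsupport (χ a) ⊆ (e a).source)
    (hsum : ∀ x ∈ D, ∑ a, χ a x = 1) (hφ : ContMDiffOn (𝓡 m) (𝓡 n) ∞ φ D) {K : Set M}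
    (hK : IsCompact K) (hKD : K ⊆ D) (h0 : ∀ x ∈ D \ K, φ x = 0) :
    ∑ b, ∫ y in (e b).target ∩ (e b).symm ⁻¹' D,
      χ b ((e b).symm y) * variationDensity (e b) f φ y = 0 := by
  have hU : ∀ b, IsOpen ((e b).target ∩ (e b).symm ⁻¹' D) := fun b =>
    (e b).isOpen_inter_preimage_symm hD
  have hψ : ∀ a, ContMDiffOn (𝓡 m) (𝓡 n) ∞ (fun x => χ a x • φ x) D := fun a =>
    (hχ a).contMDiffOn.smul hφ
  have hKo : IsOpen (D ∩ Kᶜ) := hD.inter hK.isClosed.isOpen_compl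
  have hoff : ∀ a b, ∀ y ∈ (e b).target ∩ (e b).symm ⁻¹' D, (e b).symm y ∉ K →
      variationDensity (e b) f (fun x => χ a x • φ x) y = 0 := fun a b y hy hyK =>
    variationDensity_eq_zero hKo (fun x hx => by simp [h0 x hx]) hy.1 ⟨hy.2, hyK⟩
  have hoff' : ∀ a b, ∀ y ∈ (e b).target ∩ (e b).symm ⁻¹' D, (e b).symm y ∉ tsupport (χ a) →
      variationDensity (e b) f (fun x => χ a x • φ x) y = 0 := fun a b y hy hya =>
    variationDensity_eq_zero (isClosed_tsupport (χ a)).isOpen_compl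
      (fun x hx => by simp [image_eq_zero_of_notMem_tsupport hx]) hy.1 hya
  have hdec : ∀ b, ∀ y ∈ (e b).target ∩ (e b).symm ⁻¹' D, variationDensity (e b) f φ y
      = ∑ a, variationDensity (e b) f (fun x => χ a x • φ x) y := by
    intro b y hy
    have hev : (fun z => φ ((e b).symm z)) =ᶠ[nhds y]
        fun z => ∑ a, χ a ((e b).symm z) • φ ((e b).symm z) := by
      filter_upwards [(hU b).mem_nhds hy] with z hz
      rw [← Finset.sum_smul, hsum _ hz.2, one_smul]
    have hp : partials (fun z => φ ((e b).symm z)) y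
        = ∑ a, partials (fun z => χ a ((e b).symm z) • φ ((e b).symm z)) y := by
      funext i
      rw [partials, hev.fderiv_eq, fderiv_fun_sum, Finset.sum_apply]
      · simp [partials]
      · intro a _
        exact ((contDiffOn_comp_symm (he b) (hψ a)).contDiffAt
          ((hU b).mem_nhds hy)).differentiableAt (by norm_num)
    rw [variationDensity, hp, firstVariation_sum]
    rfl
  -- In chart `b` compactness of the support comes from the weight `χ b`; in chart `a` below, it
  -- comes from the test map `χ a • φ`.
  have hint : ∀ a b, IntegrableOn (fun y => χ b ((e b).symm y) *
      variationDensity (e b) f (fun x => χ a x • φ x) y) ((e b).target ∩ (e b).symm ⁻¹' D) := by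
    intro a b
    refine integrableOn_mul_variationDensity (he b) hD hf.contMDiffOn (hψ a) (hχ b).continuous
      (hK.inter_right (isClosed_tsupport (χ b))) (inter_subset_left.trans hKD)
      (inter_subset_right.trans (hsupp b)) fun y hy hyL => ?_
    by_cases hyK : (e b).symm y ∈ K
    · rw [image_eq_zero_of_notMem_tsupport fun h => hyL ⟨hyK, h⟩, zero_mul]
    · rw [hoff a b y hy hyK, mul_zero]
  have hint' : ∀ a b, IntegrableOn (fun y => χ b ((e a).symm y) *
      variationDensity (e a) f (fun x => χ a x • φ x) y) ((e a).target ∩ (e a).symm ⁻¹' D) := by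
    intro a b
    refine integrableOn_mul_variationDensity (he a) hD hf.contMDiffOn (hψ a) (hχ b).continuous
      (hK.inter_right (isClosed_tsupport (χ a))) (inter_subset_left.trans hKD)
      (inter_subset_right.trans (hsupp a)) fun y hy hyL => ?_
    by_cases hyK : (e a).symm y ∈ K
    · rw [hoff' a a y hy fun h => hyL ⟨hyK, h⟩, mul_zero]
    · rw [hoff a a y hy hyK, mul_zero]
  -- Both integrands vanish off the overlap of the two charts, where the change of variables
  -- applies. Moving every term to chart `a` lets the weights `χ b` sum to `1`, leaving the
  -- one-chart system for `χ a • φ`.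
  have hswap : ∀ a b, ∫ y in (e b).target ∩ (e b).symm ⁻¹' D, χ b ((e b).symm y) *
        variationDensity (e b) f (fun x => χ a x • φ x) y
      = ∫ y in (e a).target ∩ (e a).symm ⁻¹' D, χ b ((e a).symm y) *
        variationDensity (e a) f (fun x => χ a x • φ x) y := by
    intro a b
    set S := D ∩ ((e a).source ∩ (e b).source) with hS
    have hSo : IsOpen S := hD.inter ((e a).open_source.inter (e b).open_source)
    have hSa : S ⊆ (e a).source := fun x hx => hx.2.1
    have hSb : S ⊆ (e b).source := fun x hx => hx.2.2
    have himg : ∀ c, S ⊆ (e c).source → (e c) '' S ⊆ (e c).target ∩ (e c).symm ⁻¹' D := by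
      rintro c hc _ ⟨x, hx, rfl⟩
      refine ⟨(e c).map_source (hc hx), ?_⟩
      rw [mem_preimage, (e c).left_inv (hc hx)]
      exact hx.1
    rw [setIntegral_eq_of_subset_of_forall_sdiff_eq_zero (hU b).measurableSet (himg b hSb),
      setIntegral_eq_of_subset_of_forall_sdiff_eq_zero (hU a).measurableSet (himg a hSa)]
    · exact integral_variationDensity_transition (he b) (he a) hSo hSb hSa
        (fun x hx => contMDiffAt_of_mem hD hf.contMDiffOn hx.1)
        (fun x hx => contMDiffAt_of_mem hD (hψ a) hx.1) (χ b)
    · intro y hy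
      rw [image_eq_zero_of_notMem_tsupport fun h => hy.2 ⟨(e a).symm y,
        ⟨hy.1.2, (e a).map_target hy.1.1, hsupp b h⟩, (e a).right_inv hy.1.1⟩, zero_mul]
    · intro y hy
      rw [hoff' a b y hy.1 fun h => hy.2 ⟨(e b).symm y,
        ⟨hy.1.2, hsupp a h, (e b).map_target hy.1.1⟩, (e b).right_inv hy.1.1⟩, mul_zero]
  calc ∑ b, ∫ y in (e b).target ∩ (e b).symm ⁻¹' D,
        χ b ((e b).symm y) * variationDensity (e b) f φ y
      = ∑ b, ∑ a, ∫ y in (e b).target ∩ (e b).symm ⁻¹' D, χ b ((e b).symm y) *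
        variationDensity (e b) f (fun x => χ a x • φ x) y := by
        refine Finset.sum_congr rfl fun b _ => ?_
        rw [← integral_finsetSum _ fun a _ => hint a b]
        refine setIntegral_congr_fun (hU b).measurableSet fun y hy => ?_
        simp only [hdec b y hy, Finset.mul_sum]
    _ = ∑ a, ∑ b, ∫ y in (e a).target ∩ (e a).symm ⁻¹' D, χ b ((e a).symm y) *
        variationDensity (e a) f (fun x => χ a x • φ x) y := by
        rw [Finset.sum_comm]
        exact Finset.sum_congr rfl fun a _ => Finset.sum_congr rfl fun b _ => hswap a b
    _ = 0 := by
        refine Finset.sum_eq_zero fun a _ => ?_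
        rw [← integral_finsetSum _ fun b _ => hint' a b]
        rw [← hf.integral_variationDensity hD (he a) (hψ a)
          (hK.inter_right (isClosed_tsupport (χ a))) (inter_subset_left.trans hKD)
          (inter_subset_right.trans (hsupp a)) ?_]
        · refine setIntegral_congr_fun (hU a).measurableSet fun y hy => ?_
          simp only [← Finset.sum_mul, hsum _ hy.2, one_mul]
        · intro x hx
          by_cases hxK : x ∈ K
          · simp [image_eq_zero_of_notMem_tsupport fun h => hx.2 ⟨hxK, h⟩]
          · simp [h0 x ⟨hx.1, hxK⟩]

end Global

/-! ### The case `m = 1`: minimal graphs are geodesics. -/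

section Curves

variable {n : ℕ} {M : Type*} [TopologicalSpace M] [ChartedSpace (EuclideanSpace ℝ (Fin 1)) M]
  [IsManifold (𝓡 1) ∞ M] [RiemannianBundle (fun x : M ↦ TangentSpace (𝓡 1) x)]

theorem firstVariation_one {W : Type*} [NormedAddCommGroup W] [InnerProductSpace ℝ W]
    (g : Matrix (Fin 1) (Fin 1) ℝ) (P Q : Fin 1 → W) :
    firstVariation g P Q = inner ℝ (P 0) (Q 0) / √(g 0 0 + ‖P 0‖ ^ 2) := by
  have h1 : (inducedMetric g P).det = g 0 0 + ‖P 0‖ ^ 2 := by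
    simp [inducedMetric, crossGram]
  have h2 : ((inducedMetric g P).adjugate * (crossGram P Q + crossGram Q P)).trace
      = 2 * inner ℝ (P 0) (Q 0) := by
    simp [crossGram, Matrix.adjugate_fin_one, Matrix.trace, real_inner_comm (Q 0)]
    ring
  rw [firstVariation, h1, h2, mul_div_mul_left _ _ two_ne_zero]

/-- The unit tangent of a curve that is a graph over the chart `e`, projected to `ℝⁿ`. -/
def flux (e : OpenPartialHomeomorph M (EuclideanSpace ℝ (Fin 1)))
    (f : M → EuclideanSpace ℝ (Fin n)) (y : EuclideanSpace ℝ (Fin 1)) : EuclideanSpace ℝ (Fin n) :=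
  (√(metricMatrix e y 0 0 + ‖partials (fun z => f (e.symm z)) y 0‖ ^ 2))⁻¹ •
    partials (fun z => f (e.symm z)) y 0

theorem metricMatrix_one_pos {e : OpenPartialHomeomorph M (EuclideanSpace ℝ (Fin 1))}
    (he : e ∈ atlas (EuclideanSpace ℝ (Fin 1)) M) {y : EuclideanSpace ℝ (Fin 1)}
    (hy : y ∈ e.target) : 0 < metricMatrix e y 0 0 := by
  have := (posDef_metricMatrix he hy).det_pos
  simpa using this

variable [IsContMDiffRiemannianBundle (𝓡 1) ∞ (EuclideanSpace ℝ (Fin 1))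
    (fun x : M ↦ TangentSpace (𝓡 1) x)]

theorem contDiffOn_flux {e : OpenPartialHomeomorph M (EuclideanSpace ℝ (Fin 1))}
    (he : e ∈ atlas (EuclideanSpace ℝ (Fin 1)) M) {D : Set M} (hD : IsOpen D)
    {f : M → EuclideanSpace ℝ (Fin n)} (hf : ContMDiffOn (𝓡 1) (𝓡 n) ∞ f D) :
    ContDiffOn ℝ ∞ (flux e f) (e.target ∩ e.symm ⁻¹' D) := by
  have hU : IsOpen (e.target ∩ e.symm ⁻¹' D) := e.isOpen_inter_preimage_symm hD
  have hP : ContDiffOn ℝ ∞ (fun y => partials (fun z => f (e.symm z)) y 0)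
      (e.target ∩ e.symm ⁻¹' D) :=
    ((contDiffOn_comp_symm he hf).fderiv_of_isOpen hU (by norm_num)).clm_apply contDiffOn_const
  have hg := (contDiffOn_metricMatrix he 0 0).mono (inter_subset_left (s := e.target)
    (t := e.symm ⁻¹' D))
  have hpos : ∀ y ∈ e.target ∩ e.symm ⁻¹' D,
      metricMatrix e y 0 0 + ‖partials (fun z => f (e.symm z)) y 0‖ ^ 2 ≠ 0 := fun y hy => by
    have := metricMatrix_one_pos he hy.1
    positivity
  refine ContDiffOn.smul (ContDiffOn.inv ((hg.add (hP.norm_sq ℝ)).sqrt hpos) fun y hy => ?_) hP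
  have := metricMatrix_one_pos he hy.1
  positivity

variable [T2Space M]

/-- This is the Euler–Lagrange equation in dimension one. The weak form with test maps `η` times a
coordinate vector, integration by parts and the fundamental lemma give it almost everywhere;
continuity gives it everywhere. -/
theorem IsMinimalMapOn.fderiv_flux {D : Set M} (hD : IsOpen D)
    {f : M → EuclideanSpace ℝ (Fin n)} (hf : IsMinimalMapOn 1 f D)
    {e : OpenPartialHomeomorph M (EuclideanSpace ℝ (Fin 1))}
    (he : e ∈ atlas (EuclideanSpace ℝ (Fin 1)) M) {y : EuclideanSpace ℝ (Fin 1)}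
    (hy : y ∈ e.target ∩ e.symm ⁻¹' D) : fderiv ℝ (flux e f) y = 0 := by
  have hU : IsOpen (e.target ∩ e.symm ⁻¹' D) := e.isOpen_inter_preimage_symm hD
  set U := e.target ∩ e.symm ⁻¹' D with hUd
  set b : EuclideanSpace ℝ (Fin 1) := EuclideanSpace.single 0 1 with hb
  have hfl : ContDiffOn ℝ ∞ (flux e f) U := contDiffOn_flux he hD hf.contMDiffOn
  have hfa : ∀ a, ContDiffOn ℝ ∞ (fun y => flux e f y a) U := fun a =>
    (EuclideanSpace.proj (𝕜 := ℝ) a).contDiff.comp_contDiffOn hfl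
  have hweak : ∀ (a : Fin n) (η : EuclideanSpace ℝ (Fin 1) → ℝ), ContDiff ℝ ∞ η →
      HasCompactSupport η → tsupport η ⊆ U → ∫ y in U, fderiv ℝ η y b * flux e f y a = 0 := by
    intro a η hη hηc hηU
    set K := e.symm '' tsupport η with hK
    have hKc : IsCompact K := hηc.isCompact.image_of_continuousOn
      (e.continuousOn_symm.mono fun y hy => (hηU hy).1)
    have hKD : K ⊆ D := by rintro _ ⟨z, hz, rfl⟩; exact (hηU hz).2
    have hKe : K ⊆ e.source := by rintro _ ⟨z, hz, rfl⟩; exact e.map_target (hηU hz).1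
    classical
    set ψ : M → EuclideanSpace ℝ (Fin n) := fun x =>
      if x ∈ e.source then η (e x) • EuclideanSpace.single a 1 else 0 with hψ
    have hψ0 : ∀ x, x ∉ K → ψ x = 0 := by
      intro x hx
      simp only [hψ]
      split_ifs with h
      · rw [image_eq_zero_of_notMem_tsupport fun h' => hx ⟨_, h', e.left_inv h⟩, zero_smul]
      · rfl
    have hψs : ContMDiffOn (𝓡 1) (𝓡 n) ∞ ψ D := by
      intro x hx
      apply ContMDiffAt.contMDiffWithinAt
      by_cases hxe : x ∈ e.source
      · have h1 : ContMDiffAt (𝓡 1) (𝓡 1) ∞ e x :=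
          (contMDiffOn_of_mem_maximalAtlas (IsManifold.subset_maximalAtlas he)).contMDiffAt
            (e.open_source.mem_nhds hxe)
        have h2 : ContMDiffAt (𝓡 1) (𝓡 n) ∞
            (fun z => η z • (EuclideanSpace.single a 1 : EuclideanSpace ℝ (Fin n))) (e x) :=
          (hη.smul contDiff_const).contMDiff.contMDiffAt
        refine (h2.comp x h1).congr_of_eventuallyEq ?_
        filter_upwards [e.open_source.mem_nhds hxe] with z hz
        simp [hψ, hz]
      · have : ψ =ᶠ[nhds x] fun _ => 0 := by
          filter_upwards [hKc.isClosed.isOpen_compl.mem_nhds fun h => hxe (hKe h)] with z hz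
          exact hψ0 z hz
        exact contMDiffAt_const.congr_of_eventuallyEq this
    have h := hf.integral_variationDensity hD he hψs hKc hKD hKe fun x hx => hψ0 x hx.2
    rw [← h]
    refine setIntegral_congr_fun hU.measurableSet fun z hz => ?_
    have hev : (fun z => ψ (e.symm z)) =ᶠ[nhds z]
        fun z => η z • (EuclideanSpace.single a 1 : EuclideanSpace ℝ (Fin n)) := by
      filter_upwards [hU.mem_nhds hz] with z hz
      simp [hψ, e.map_target hz.1, e.right_inv hz.1]
    have hp : partials (fun z => ψ (e.symm z)) z 0
        = fderiv ℝ η z b • EuclideanSpace.single a 1 := by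
      rw [partials, hev.fderiv_eq,
        ((hη.differentiable (by norm_num) z).hasFDerivAt.smul_const _).fderiv]
      rfl
    simp only [variationDensity]
    rw [firstVariation_one, hp, inner_smul_right, EuclideanSpace.inner_single_right]
    simp [flux]
    ring
  have hda : ∀ a, ∀ z ∈ U, fderiv ℝ (fun y => flux e f y a) z b = 0 := by
    intro a
    have hcont : ContinuousOn (fun z => fderiv ℝ (fun y => flux e f y a) z b) U :=
      ((hfa a).continuousOn_fderiv_of_isOpen hU (by norm_num)).clm_apply continuousOn_const
    have hae := hU.ae_eq_zero_of_integral_contDiff_smul_eq_zero (μ := volume)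
      (hcont.locallyIntegrableOn hU.measurableSet) (fun η hη hηc hηU => ?_)
    · exact Measure.eqOn_open_of_ae_eq (g := fun _ => (0 : ℝ)) (μ := volume)
        ((ae_restrict_iff' hU.measurableSet).2 hae) hU hcont continuousOn_const
    · have hη0 : ∀ z ∉ tsupport η, η z = 0 := fun z => image_eq_zero_of_notMem_tsupport
      have hη1 : ∀ z ∉ tsupport η, fderiv ℝ η z = 0 := fun z hz => by
        by_contra hne
        exact hz (support_fderiv_subset ℝ hne)
      have hfc := (hfa a).continuousOn.mono hηU
      have h := integral_mul_fderiv_eq_neg_fderiv_mul_of_integrable (μ := volume) (f := η)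
        (g := fun y => flux e f y a) (v := b)
        ((((((hη.continuous_fderiv (by norm_num)).clm_apply continuous_const).continuousOn.mul
          hfc)).integrableOn_compact hηc.isCompact).integrable_of_forall_notMem_eq_zero
          fun z hz => by simp [hη1 z hz])
        (((hη.continuous.continuousOn.mul (hcont.mono hηU)).integrableOn_compact
          hηc.isCompact).integrable_of_forall_notMem_eq_zero fun z hz => by simp [hη0 z hz])
        (((hη.continuous.continuousOn.mul hfc).integrableOn_compact
          hηc.isCompact).integrable_of_forall_notMem_eq_zero fun z hz => by simp [hη0 z hz])
        (fun z _ => hη.differentiable (by norm_num) z)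
        (fun z hz => ((hfa a).contDiffAt (hU.mem_nhds (hηU hz))).differentiableAt (by norm_num))
      rw [← setIntegral_eq_integral_of_forall_compl_eq_zero (s := U)
        (f := fun z => fderiv ℝ η z b * flux e f z a)
        (fun z hz => by simp [hη1 z fun h => hz (hηU h)]), hweak a η hη hηc hηU, neg_zero] at h
      exact h
  have hdiff : DifferentiableAt ℝ (flux e f) y :=
    (hfl.contDiffAt (hU.mem_nhds hy)).differentiableAt (by norm_num)
  have hb0 : fderiv ℝ (flux e f) y b = 0 := by
    ext a
    have h := hda a y hy
    have h' : fderiv ℝ (fun y => flux e f y a) y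
        = (EuclideanSpace.proj (𝕜 := ℝ) a).comp (fderiv ℝ (flux e f) y) :=
      ((EuclideanSpace.proj (𝕜 := ℝ) a).hasFDerivAt.comp y hdiff.hasFDerivAt).fderiv
    rw [h'] at h
    simpa using h
  ext v : 1
  have hv : v = v 0 • b := by
    ext i
    fin_cases i
    simp [hb]
  rw [hv, map_smul, hb0]
  simp

end Curves

/-! ### A uniform bound for the differential of a minimal map. -/

section Bound

theorem finrank_tangentSpace {m : ℕ} {M : Type*} [TopologicalSpace M]
    [ChartedSpace (EuclideanSpace ℝ (Fin m)) M] (x : M) :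
    Module.finrank ℝ (TangentSpace (𝓡 m) x) = m :=
  finrank_euclideanSpace_fin (𝕜 := ℝ) (n := m)

/-- The differential of a map into `ℝⁿ`, as a linear map. -/
def differential {m n : ℕ} {M : Type*} [TopologicalSpace M]
    [ChartedSpace (EuclideanSpace ℝ (Fin m)) M] (f : M → EuclideanSpace ℝ (Fin n)) (x : M) :
    TangentSpace (𝓡 m) x →ₗ[ℝ] EuclideanSpace ℝ (Fin n) :=
  (mfderiv (𝓡 m) (𝓡 n) f x).toLinearMap

theorem IsMinimalMapOn.eventually_norm_mfderiv_sq {n : ℕ} {M : Type*} [TopologicalSpace M]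
    [T2Space M] [ChartedSpace (EuclideanSpace ℝ (Fin 1)) M]
    [IsManifold (𝓡 1) ∞ M] [RiemannianBundle (fun x : M ↦ TangentSpace (𝓡 1) x)]
    [IsContMDiffRiemannianBundle (𝓡 1) ∞ (EuclideanSpace ℝ (Fin 1))
      (fun x : M ↦ TangentSpace (𝓡 1) x)] {D : Set M} (hD : IsOpen D)
    {f : M → EuclideanSpace ℝ (Fin n)} (hf : IsMinimalMapOn 1 f D) {x : M} (hx : x ∈ D) :
    ∃ r : ℝ, ∀ᶠ x' in nhds x, ∀ u : TangentSpace (𝓡 1) x',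
      ‖differential f x' u‖ ^ 2 = r * ‖u‖ ^ 2 := by
  have : IsManifold (𝓡 1) 1 M := IsManifold.of_le (n := ∞) (by norm_num)
  set e := chartAt (EuclideanSpace ℝ (Fin 1)) x with hed
  have he : e ∈ atlas (EuclideanSpace ℝ (Fin 1)) M := chart_mem_atlas _ x
  have hU : IsOpen (e.target ∩ e.symm ⁻¹' D) := e.isOpen_inter_preimage_symm hD
  have hxe : x ∈ e.source := mem_chart_source _ x
  have hxU : e x ∈ e.target ∩ e.symm ⁻¹' D :=
    ⟨e.map_source hxe, by rwa [mem_preimage, e.left_inv hxe]⟩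
  obtain ⟨δ, hδ, hball⟩ := Metric.isOpen_iff.1 hU _ hxU
  set κ := ‖flux e f (e x)‖ ^ 2 with hκ
  -- With `p` the squared partial derivative and `g` the metric coefficient, the squared flux is `κ
  -- = p / (g + p)`, so `p / g = κ / (1 - κ)`.
  refine ⟨κ / (1 - κ), ?_⟩
  have hconst : ∀ y ∈ Metric.ball (e x) δ, flux e f y = flux e f (e x) := by
    intro y hy
    refine Metric.isOpen_ball.is_const_of_fderiv_eq_zero (𝕜 := ℝ)
      (convex_ball (e x) δ).isPreconnected
      (((contDiffOn_flux he hD hf.contMDiffOn).mono hball).differentiableOn (by norm_num))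
      (fun z hz => hf.fderiv_flux hD he (hball hz)) hy (Metric.mem_ball_self hδ)
  filter_upwards [e.open_source.mem_nhds hxe,
    (e.continuousAt hxe).eventually (Metric.ball_mem_nhds _ hδ)] with x' hx' hx'b
  obtain ⟨y, hy, rfl⟩ : ∃ y ∈ Metric.ball (e x) δ, e.symm y = x' := ⟨e x', hx'b, e.left_inv hx'⟩
  intro u
  have hyU := hball hy
  have hspan : ∀ v : EuclideanSpace ℝ (Fin 1), v = v 0 • EuclideanSpace.single 0 1 := by
    intro v
    ext i
    fin_cases i
    simp
  obtain ⟨lam, hu⟩ : ∃ lam : ℝ, u = lam • chartFrame e y 0 := by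
    obtain ⟨v, hv⟩ := ((mdifferentiable_of_mem_atlas (I := 𝓡 1) he).symm).mfderiv_surjective
      hyU.1 u
    rw [← hv, hspan v]
    exact ⟨_, map_smul _ _ _⟩
  have hP := congrFun (partials_comp_symm he hyU.1
    (contMDiffAt_of_mem hD hf.contMDiffOn hyU.2)) 0
  have hg : metricMatrix e y 0 0 = ‖chartFrame e y 0‖ ^ 2 :=
    real_inner_self_eq_norm_sq (chartFrame e y 0)
  have hgp := metricMatrix_one_pos he hyU.1
  have hfl : ‖flux e f y‖ ^ 2 = κ := by rw [hconst y hy]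
  rw [flux, norm_smul, mul_pow, norm_inv, Real.norm_eq_abs, inv_pow, sq_abs,
    Real.sq_sqrt (by positivity)] at hfl
  have hAu : ‖differential f (e.symm y) u‖ ^ 2
      = lam ^ 2 * ‖partials (fun z => f (e.symm z)) y 0‖ ^ 2 := by
    rw [hP, hu, map_smul, norm_smul, mul_pow, Real.norm_eq_abs, sq_abs]
    rfl
  have hun : ‖u‖ ^ 2 = lam ^ 2 * metricMatrix e y 0 0 := by
    rw [hg, hu, norm_smul, mul_pow, Real.norm_eq_abs, sq_abs]
  rw [hAu, hun]
  set p := ‖partials (fun z => f (e.symm z)) y 0‖ ^ 2 with hp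
  set g := metricMatrix e y 0 0
  have hp0 : 0 ≤ p := sq_nonneg _
  have h1 : 1 - κ = g / (g + p) := by
    rw [← hfl]; field_simp; ring
  rw [h1, ← hfl]
  field_simp

variable {m n : ℕ} {M : Type*} [TopologicalSpace M]
    [T2Space M] [ChartedSpace (EuclideanSpace ℝ (Fin m)) M]
    [IsManifold (𝓡 m) ∞ M] [RiemannianBundle (fun x : M ↦ TangentSpace (𝓡 m) x)]
    [IsContMDiffRiemannianBundle (𝓡 m) ∞ (EuclideanSpace ℝ (Fin m))
      (fun x : M ↦ TangentSpace (𝓡 m) x)]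

/-- The membership in `C` bounds singular values only for `m ≥ 2`: when `m = 1`, `setM` is all of
`ℝ¹`. In that case the slope is locally constant, hence constant on the connected set `D`. -/
theorem IsMinimalMapOn.exists_bound {D : Set M} (hD : IsOpen D) (hDc : IsConnected D)
    {C : Set (Fin m → ℝ)} (hCs : IsSymmetric C) (hCc : Convex ℝ C) (hCM : C ⊆ closure (setM m))
    {f : M → EuclideanSpace ℝ (Fin n)} (hf : IsMinimalMapOn m f D)
    (hC : ∀ x ∈ D, singularValueVector f x ∈ C) :
    ∃ R : ℝ, ∀ x ∈ D, ∀ u : TangentSpace (𝓡 m) x,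
      ‖differential f x u‖ ^ 2 ≤ R * ‖u‖ ^ 2 := by
  have key : ∀ R : ℝ, (∀ x ∈ D, ∀ i, singularValueVector f x i ^ 2 ≤ R) →
      ∀ x ∈ D, ∀ u : TangentSpace (𝓡 m) x,
      ‖differential f x u‖ ^ 2 ≤ R * ‖u‖ ^ 2 :=
    fun R hR x hx u => norm_map_sq_le_of_singularValues_le (V := TangentSpace (𝓡 m) x)
      (W := EuclideanSpace ℝ (Fin n)) (finrank_tangentSpace x)
      (A := differential f x) (hR x hx) u
  have h0 : ∀ (x : M) (i : Fin m), 0 ≤ singularValueVector f x i := fun x i =>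
    LinearMap.singularValues_nonneg (E := TangentSpace (𝓡 m) x) (F := EuclideanSpace ℝ (Fin n)) _ i
  by_cases hm : m = 1
  · subst hm
    obtain ⟨x₀, hx₀⟩ := hDc.nonempty
    refine ⟨singularValueVector f x₀ (0 : Fin 1) ^ 2, key _ fun x hx i => ?_⟩
    have hsv : ∀ (x' : M) (r : ℝ), (∀ u : TangentSpace (𝓡 1) x',
        ‖differential f x' u‖ ^ 2 = r * ‖u‖ ^ 2) →
        singularValueVector f x' (0 : Fin 1) ^ 2 = r := by
      intro x' r hr
      obtain ⟨o, ho⟩ := exists_orthonormalBasis_inner_map (V := TangentSpace (𝓡 1) x')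
        (W := EuclideanSpace ℝ (Fin n)) (finrank_tangentSpace x')
        (differential f x')
      have h1 := ho 0 0
      have h2 := hr (o 0)
      rw [o.norm_eq_one] at h2
      rw [if_pos rfl] at h1
      have h3 : singularValueVector f x' (0 : Fin 1) ^ 2
        = ‖differential f x' (o 0)‖ ^ 2 :=
        h1.symm.trans (real_inner_self_eq_norm_sq _)
      rw [h3, h2]; ring
    have hloc := hDc.isPreconnected.induction₂
      (fun x y => singularValueVector f x (0 : Fin 1) ^ 2
        = singularValueVector f y (0 : Fin 1) ^ 2)
      (fun x hx => by
        obtain ⟨r, hr⟩ := hf.eventually_norm_mfderiv_sq hD hx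
        have hrx := hsv x r hr.self_of_nhds
        filter_upwards [mem_nhdsWithin_of_mem_nhds hr] with x' hx'
        rw [hrx, hsv x' r hx'])
      (fun _ _ _ _ _ _ h h' => h.trans h') (fun _ _ _ _ h => h.symm) hx₀ hx
    fin_cases i
    exact hloc.symm.le
  · refine ⟨2 ^ 2, key _ fun x hx i => ?_⟩
    -- The index `i` excludes `m = 0`, where there is nothing to bound.
    have hm2 : 2 ≤ m := by have := i.pos; omega
    exact pow_le_pow_left₀ (h0 x i) (le_two_of_mem hCs hCc hCM hm2 (hC x hx) (h0 x) i) 2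

end Bound

/-! ### Smooth truncation of vectors near the origin. -/

section Truncation

variable {W : Type*} [NormedAddCommGroup W] [InnerProductSpace ℝ W]

/-- A smooth map that vanishes near the origin and is the identity far away. -/
def truncation (w : W) : W := Real.smoothTransition (‖w‖ ^ 2 - 1) • w

theorem contDiff_truncation : ContDiff ℝ ∞ (truncation : W → W) :=
  (Real.smoothTransition.contDiff.comp ((contDiff_norm_sq ℝ).sub contDiff_const)).smul contDiff_id

theorem truncation_of_norm_le {w : W} (hw : ‖w‖ ^ 2 ≤ 1) : truncation w = 0 := by
  rw [truncation, Real.smoothTransition.zero_of_nonpos (by linarith), zero_smul]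

theorem fderiv_truncation_zero : fderiv ℝ (truncation : W → W) 0 = 0 := by
  have : (truncation : W → W) =ᶠ[nhds 0] fun _ => 0 := by
    have hc : Continuous fun w : W => ‖w‖ ^ 2 := by fun_prop
    have := hc.continuousAt (x := 0) |>.eventually (gt_mem_nhds (show ‖(0 : W)‖ ^ 2 < 1 by simp))
    filter_upwards [this] with w hw using truncation_of_norm_le hw.le
  rw [this.fderiv_eq]
  simp

theorem fderiv_truncation_of_lt {w : W} (hw : 2 < ‖w‖ ^ 2) :
    fderiv ℝ (truncation : W → W) w = ContinuousLinearMap.id ℝ W := by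
  have : (truncation : W → W) =ᶠ[nhds w] id := by
    have hc : Continuous fun w : W => ‖w‖ ^ 2 := by fun_prop
    filter_upwards [hc.continuousAt.eventually (lt_mem_nhds hw)] with z hz
    rw [truncation, Real.smoothTransition.one_of_one_le (by linarith), one_smul, id]
  rw [this.fderiv_eq, fderiv_id]

/-- The rescalings `s⁻¹ • truncation (s • ·)` inherit the same constant for all `s`, which yields
domination uniform in the truncation level. -/
theorem exists_bound_fderiv_truncation [FiniteDimensional ℝ W] :
    ∃ B : ℝ, ∀ w h : W, ‖fderiv ℝ (truncation : W → W) w h‖ ≤ B * ‖h‖ := by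
  obtain ⟨B, hB⟩ := (isCompact_closedBall (0 : W) 2).exists_bound_of_continuousOn
    (contDiff_truncation.continuous_fderiv (by norm_num)).continuousOn
  refine ⟨max B 1, fun w h => (ContinuousLinearMap.le_opNorm _ _).trans
    (mul_le_mul_of_nonneg_right ?_ (norm_nonneg _))⟩
  by_cases hw : 2 < ‖w‖ ^ 2
  · rw [fderiv_truncation_of_lt hw]
    exact ContinuousLinearMap.norm_id_le.trans (le_max_right _ _)
  · refine (hB w ?_).trans (le_max_left _ _)
    rw [mem_closedBall_zero_iff]
    nlinarith [norm_nonneg w]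

theorem tendsto_fderiv_truncation {w : W} (hw : w ≠ 0) :
    ∀ᶠ k : ℕ in Filter.atTop,
      fderiv ℝ (truncation : W → W) (((k : ℝ) + 1) • w) = ContinuousLinearMap.id ℝ W := by
  have hw' : 0 < ‖w‖ := norm_pos_iff.2 hw
  obtain ⟨N, hN⟩ := exists_nat_gt (2 / ‖w‖)
  filter_upwards [Filter.eventually_ge_atTop N] with k hk
  refine fderiv_truncation_of_lt ?_
  have hk' : (N : ℝ) ≤ k := by exact_mod_cast hk
  have h1 : 2 < ((k : ℝ) + 1) * ‖w‖ := by
    rw [div_lt_iff₀ hw'] at hN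
    nlinarith
  rw [norm_smul, Real.norm_eq_abs, abs_of_nonneg (by positivity)]
  nlinarith

end Truncation

/-! ### Finite partitions of unity and the pointwise gap between first variations. -/

section Gap

variable {m n : ℕ} {M : Type*} [TopologicalSpace M] [ChartedSpace (EuclideanSpace ℝ (Fin m)) M]

theorem exists_finite_partition [T2Space M] [SecondCountableTopology M] [IsManifold (𝓡 m) ∞ M]
    {K : Set M} (hK : IsCompact K) :
    ∃ (t : Finset M) (χ : t → M → ℝ), (∀ a, ContMDiff (𝓡 m) 𝓘(ℝ, ℝ) ∞ (χ a)) ∧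
      (∀ a, tsupport (χ a) ⊆ (chartAt (EuclideanSpace ℝ (Fin m)) (a : M)).source) ∧
      (∀ a x, 0 ≤ χ a x) ∧ ∀ x ∈ K, ∑ a, χ a x = 1 := by
  have : LocallyCompactSpace M := ChartedSpace.locallyCompactSpace (EuclideanSpace ℝ (Fin m)) M
  obtain ⟨t, ht⟩ := hK.elim_finite_subcover
    (fun x : M => (chartAt (EuclideanSpace ℝ (Fin m)) x).source)
    (fun x => (chartAt (EuclideanSpace ℝ (Fin m)) x).open_source)
    (fun x _ => mem_iUnion.2 ⟨x, mem_chart_source _ x⟩)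
  obtain ⟨f, hf⟩ := SmoothPartitionOfUnity.exists_isSubordinate (𝓡 m) hK.isClosed
    (fun a : t => (chartAt (EuclideanSpace ℝ (Fin m)) (a : M)).source)
    (fun a => (chartAt (EuclideanSpace ℝ (Fin m)) (a : M)).open_source)
    (fun x hx => by
      obtain ⟨a, ha, hxa⟩ := mem_iUnion₂.1 (ht hx)
      exact mem_iUnion.2 ⟨⟨a, ha⟩, hxa⟩)
  refine ⟨t, fun a => f a, fun a => (f a).contMDiff, hf, fun a x => f.nonneg a x, fun x hx => ?_⟩
  rw [← finsum_eq_sum_of_fintype]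
  exact f.sum_eq_one hx

variable [IsManifold (𝓡 m) ∞ M] [RiemannianBundle (fun x : M ↦ TangentSpace (𝓡 m) x)]

theorem variationDensity_gap {D : Set M} (hD : IsOpen D) {C : Set (Fin m → ℝ)}
    (hCs : IsSymmetric C) (hCc : Convex ℝ C) (hCM : C ⊆ closure (setM m))
    {f₀ f₁ : M → EuclideanSpace ℝ (Fin n)} (hf₀ : ContMDiffOn (𝓡 m) (𝓡 n) ∞ f₀ D)
    (hf₁ : ContMDiffOn (𝓡 m) (𝓡 n) ∞ f₁ D) (hC₀ : ∀ x ∈ D, singularValueVector f₀ x ∈ C)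
    (hC₁ : ∀ x ∈ D, singularValueVector f₁ x ∈ C)
    {e : OpenPartialHomeomorph M (EuclideanSpace ℝ (Fin m))}
    (he : e ∈ atlas (EuclideanSpace ℝ (Fin m)) M) {y : EuclideanSpace ℝ (Fin m)}
    (hy : y ∈ e.target ∩ e.symm ⁻¹' D) :
    variationDensity e f₀ (fun x => f₁ x - f₀ x) y ≤ variationDensity e f₁ (fun x => f₁ x - f₀ x) y ∧
    (variationDensity e f₀ (fun x => f₁ x - f₀ x) y = variationDensity e f₁ (fun x => f₁ x - f₀ x) y
      → differential (m := m) f₀ (e.symm y) = differential (m := m) f₁ (e.symm y)) := by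
  have hU := (e.isOpen_inter_preimage_symm hD).mem_nhds hy
  have h₀ := partials_comp_symm he hy.1 (contMDiffAt_of_mem hD hf₀ hy.2)
  have h₁ := partials_comp_symm he hy.1 (contMDiffAt_of_mem hD hf₁ hy.2)
  have hv : partials (fun z => f₁ (e.symm z) - f₀ (e.symm z)) y = fun i =>
      differential f₁ (e.symm y) (chartFrame e y i)
        - differential f₀ (e.symm y) (chartFrame e y i) := by
    funext i
    have d₀ := ((contDiffOn_comp_symm he hf₀).contDiffAt hU).differentiableAt (by norm_num)
    have d₁ := ((contDiffOn_comp_symm he hf₁).contDiffAt hU).differentiableAt (by norm_num)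
    rw [partials, (d₁.hasFDerivAt.fun_sub d₀.hasFDerivAt).fderiv]
    have e₀ := congrFun h₀ i
    have e₁ := congrFun h₁ i
    simp only [partials] at e₀ e₁
    rw [_root_.sub_apply, e₀, e₁]
    rfl
  have hgap := firstVariation_gap (V := TangentSpace (𝓡 m) (e.symm y))
    (W := EuclideanSpace ℝ (Fin n)) hCs hCc hCM (finrank_tangentSpace (e.symm y))
    (A₀ := differential f₀ (e.symm y)) (A₁ := differential f₁ (e.symm y))
    (hC₀ _ hy.2) (hC₁ _ hy.2) (linearIndependent_chartFrame he hy.1)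
  simp only [variationDensity]
  rw [hv, h₀, h₁]
  exact hgap

end Gap

/-! ### Equality of the differentials where the two maps differ. -/

section Uniqueness

theorem ae_eq_zero_of_tendsto_of_sum_integral_eq_zero {ι E : Type*} [Fintype ι] [MeasurableSpace E]
    {μ : ι → Measure E} {G : ℕ → ι → E → ℝ} {g H : ι → E → ℝ}
    (hG : ∀ k b, AEStronglyMeasurable (G k b) (μ b)) (hg : ∀ b, Integrable (g b) (μ b))
    (hGg : ∀ k b, ∀ᵐ y ∂μ b, ‖G k b y‖ ≤ g b y)
    (hlim : ∀ b, ∀ᵐ y ∂μ b, Filter.Tendsto (fun k => G k b y) Filter.atTop (nhds (H b y)))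
    (hsum : ∀ k, ∑ b, ∫ y, G k b y ∂μ b = 0) (hH : ∀ b, 0 ≤ᵐ[μ b] H b) (b : ι) :
    H b =ᵐ[μ b] 0 := by
  have hHi : ∀ b, Integrable (H b) (μ b) := fun b => by
    refine (hg b).mono' (aestronglyMeasurable_of_tendsto_ae Filter.atTop (fun k => hG k b) (hlim b)) ?_
    filter_upwards [hlim b, ae_all_iff.2 fun k => hGg k b] with y h1 h2
    exact le_of_tendsto h1.norm (Filter.Eventually.of_forall h2)
  have h1 : Filter.Tendsto (fun k => ∑ b, ∫ y, G k b y ∂μ b) Filter.atTop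
      (nhds (∑ b, ∫ y, H b y ∂μ b)) :=
    tendsto_finsetSum _ fun b _ => tendsto_integral_of_dominated_convergence (g b)
      (fun k => hG k b) (hg b) (fun k => hGg k b) (hlim b)
  simp only [hsum] at h1
  have h2 : ∑ b, ∫ y, H b y ∂μ b = 0 := tendsto_nhds_unique h1 tendsto_const_nhds |>.symm ▸ rfl
  have h3 := (Finset.sum_eq_zero_iff_of_nonneg
    fun b _ => integral_nonneg_of_ae (hH b)).1 h2 b (Finset.mem_univ b)
  exact (integral_eq_zero_iff_of_nonneg_ae (hH b) (hHi b)).1 h3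

variable {m n : ℕ} {M : Type*} [TopologicalSpace M] [ChartedSpace (EuclideanSpace ℝ (Fin m)) M]
  [IsManifold (𝓡 m) ∞ M] [RiemannianBundle (fun x : M ↦ TangentSpace (𝓡 m) x)]

theorem norm_partials_sq_le {D : Set M} (hD : IsOpen D) {f : M → EuclideanSpace ℝ (Fin n)}
    (hf : ContMDiffOn (𝓡 m) (𝓡 n) ∞ f D) {R : ℝ}
    (hR : ∀ x ∈ D, ∀ u : TangentSpace (𝓡 m) x, ‖differential f x u‖ ^ 2 ≤ R * ‖u‖ ^ 2)
    {e : OpenPartialHomeomorph M (EuclideanSpace ℝ (Fin m))}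
    (he : e ∈ atlas (EuclideanSpace ℝ (Fin m)) M) {y : EuclideanSpace ℝ (Fin m)}
    (hy : y ∈ e.target ∩ e.symm ⁻¹' D) (i : Fin m) :
    ‖partials (fun z => f (e.symm z)) y i‖ ^ 2 ≤ R * metricMatrix e y i i := by
  rw [partials_comp_symm he hy.1 (contMDiffAt_of_mem hD hf hy.2)]
  have hg : metricMatrix e y i i = ‖chartFrame e y i‖ ^ 2 :=
    real_inner_self_eq_norm_sq (chartFrame e y i)
  rw [hg]
  exact hR _ hy.2 (chartFrame e y i)

variable [IsContMDiffRiemannianBundle (𝓡 m) ∞ (EuclideanSpace ℝ (Fin m))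
    (fun x : M ↦ TangentSpace (𝓡 m) x)]

theorem exists_bound_firstVariation {e : OpenPartialHomeomorph M (EuclideanSpace ℝ (Fin m))}
    (he : e ∈ atlas (EuclideanSpace ℝ (Fin m)) M) {L : Set (EuclideanSpace ℝ (Fin m))}
    (hL : IsCompact L) (hLe : L ⊆ e.target) (r s : ℝ) :
    ∃ B : ℝ, ∀ y ∈ L, ∀ P Q : Fin m → EuclideanSpace ℝ (Fin n), ‖P‖ ≤ r → ‖Q‖ ≤ s →
      ‖firstVariation (metricMatrix e y) P Q‖ ≤ B := by
  have hc : ContinuousOn (fun q : EuclideanSpace ℝ (Fin m) ×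
      ((Fin m → EuclideanSpace ℝ (Fin n)) × (Fin m → EuclideanSpace ℝ (Fin n))) =>
      firstVariation (metricMatrix e q.1) q.2.1 q.2.2)
      (L ×ˢ (Metric.closedBall 0 r ×ˢ Metric.closedBall 0 s)) :=
    continuousOn_firstVariation
      (((continuousOn_metricMatrix he).mono hLe).comp continuousOn_fst fun q hq => hq.1)
      (continuous_fst.comp continuous_snd).continuousOn
      (continuous_snd.comp continuous_snd).continuousOn
      fun q hq => posDef_metricMatrix he (hLe hq.1)
  obtain ⟨B, hB⟩ := (hL.prod ((isCompact_closedBall 0 r).prod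
    (isCompact_closedBall 0 s))).exists_bound_of_continuousOn hc
  exact ⟨B, fun y hy P Q hP hQ => hB (y, P, Q)
    ⟨hy, mem_closedBall_zero_iff.2 hP, mem_closedBall_zero_iff.2 hQ⟩⟩

theorem exists_bound_partials {D : Set M} (hD : IsOpen D) {f : M → EuclideanSpace ℝ (Fin n)}
    (hf : ContMDiffOn (𝓡 m) (𝓡 n) ∞ f D) {R : ℝ}
    (hR : ∀ x ∈ D, ∀ u : TangentSpace (𝓡 m) x, ‖differential f x u‖ ^ 2 ≤ R * ‖u‖ ^ 2)
    {e : OpenPartialHomeomorph M (EuclideanSpace ℝ (Fin m))}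
    (he : e ∈ atlas (EuclideanSpace ℝ (Fin m)) M) {L : Set (EuclideanSpace ℝ (Fin m))}
    (hL : IsCompact L) (hLe : L ⊆ e.target) :
    ∃ r : ℝ, 0 ≤ r ∧ ∀ y ∈ L ∩ (e.target ∩ e.symm ⁻¹' D),
      ‖partials (fun z => f (e.symm z)) y‖ ≤ r := by
  have hc : ContinuousOn (fun y => ∑ i, |R * metricMatrix e y i i|) L :=
    continuousOn_finsetSum _ fun i _ =>
      (continuousOn_const.mul ((contDiffOn_metricMatrix he i i).continuousOn.mono hLe)).abs
  obtain ⟨B, hB⟩ := hL.exists_bound_of_continuousOn hc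
  refine ⟨√B, Real.sqrt_nonneg _, fun y hy => ?_⟩
  refine (pi_norm_le_iff_of_nonneg (Real.sqrt_nonneg _)).2 fun i => Real.le_sqrt_of_sq_le ?_
  refine (norm_partials_sq_le hD hf hR he hy.2 i).trans ((le_abs_self _).trans ?_)
  refine le_trans ?_ ((le_abs_self _).trans (hB y hy.1))
  exact Finset.single_le_sum (f := fun i => |R * metricMatrix e y i i|)
    (fun i _ => abs_nonneg _) (Finset.mem_univ i)

theorem differential_eq_of_ne [T2Space M] [SecondCountableTopology M] {D : Set M}
    (hDo : IsOpen D) (hDc : IsConnected D) (hDb : IsCompact (closure D))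
    {C : Set (Fin m → ℝ)} (hCs : IsSymmetric C) (hCc : Convex ℝ C) (hCM : C ⊆ closure (setM m))
    {f₀ f₁ : M → EuclideanSpace ℝ (Fin n)} (hc₀ : ContinuousOn f₀ (closure D))
    (hc₁ : ContinuousOn f₁ (closure D)) (hf₀ : IsMinimalMapOn m f₀ D) (hf₁ : IsMinimalMapOn m f₁ D)
    (hbd : EqOn f₀ f₁ (frontier D)) (hC₀ : ∀ x ∈ D, singularValueVector f₀ x ∈ C)
    (hC₁ : ∀ x ∈ D, singularValueVector f₁ x ∈ C) {x : M} (hx : x ∈ D) (hne : f₁ x - f₀ x ≠ 0) :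
    differential (m := m) f₀ x = differential (m := m) f₁ x := by
  obtain ⟨t, χ, hχ, hsupp, hχ0, hsum⟩ := exists_finite_partition (m := m) hDb
  set e : t → OpenPartialHomeomorph M (EuclideanSpace ℝ (Fin m)) := fun a =>
    chartAt (EuclideanSpace ℝ (Fin m)) (a : M) with hed
  have he : ∀ a, e a ∈ atlas (EuclideanSpace ℝ (Fin m)) M := fun a => chart_mem_atlas _ _
  have hsumD : ∀ x ∈ D, ∑ a, χ a x = 1 := fun x hx => hsum x (subset_closure hx)
  obtain ⟨R₀, hR₀⟩ := hf₀.exists_bound hDo hDc hCs hCc hCM hC₀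
  obtain ⟨R₁, hR₁⟩ := hf₁.exists_bound hDo hDc hCs hCc hCM hC₁
  obtain ⟨B, hB⟩ := exists_bound_fderiv_truncation (W := EuclideanSpace ℝ (Fin n))
  set v : M → EuclideanSpace ℝ (Fin n) := fun x => f₁ x - f₀ x with hv
  have hvs : ContMDiffOn (𝓡 m) (𝓡 n) ∞ v D := hf₁.contMDiffOn.sub hf₀.contMDiffOn
  have hvc : ContinuousOn v (closure D) := hc₁.sub hc₀
  set s : ℕ → ℝ := fun k => (k : ℝ) + 1 with hs
  have hs0 : ∀ k, s k ≠ 0 := fun k => by simp only [hs]; positivity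
  -- The test map vanishes where `‖v‖ ≤ 1 / s k`, and its differential is that of `v` where `‖v‖² >
  -- 2 / s k ^ 2`.
  set φ : ℕ → M → EuclideanSpace ℝ (Fin n) := fun k x => (s k)⁻¹ • truncation (s k • v x) with hφ
  set U : t → Set (EuclideanSpace ℝ (Fin m)) := fun b => (e b).target ∩ (e b).symm ⁻¹' D with hUd
  have hU : ∀ b, IsOpen (U b) := fun b => (e b).isOpen_inter_preimage_symm hDo
  have hφs : ∀ k, ContMDiffOn (𝓡 m) (𝓡 n) ∞ (φ k) D := by
    intro k
    have h1 : ContDiff ℝ ∞ fun w : EuclideanSpace ℝ (Fin n) => (s k)⁻¹ • truncation (s k • w) :=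
      (contDiff_truncation.comp (contDiff_const_smul (s k))).const_smul _
    exact h1.contMDiff.comp_contMDiffOn hvs
  -- This compact set avoids the frontier, where `v = 0`; here the boundary condition makes the test
  -- maps admissible.
  set K : ℕ → Set M := fun k => closure D ∩ (fun x => ‖s k • v x‖ ^ 2) ⁻¹' Ici 1 with hKd
  have hK : ∀ k, IsCompact (K k) := fun k =>
    hDb.of_isClosed_subset (((hvc.const_smul (s k)).norm.pow 2).preimage_isClosed_of_isClosed
      isClosed_closure isClosed_Ici) inter_subset_left
  have hKD : ∀ k, K k ⊆ D := by
    intro k x hx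
    by_contra hxD
    have hxf : x ∈ frontier D := by rw [hDo.frontier_eq]; exact ⟨hx.1, hxD⟩
    have h0 : v x = 0 := by simp [hv, hbd hxf]
    have := hx.2
    simp only [mem_preimage, h0, smul_zero, norm_zero, mem_Ici] at this
    norm_num at this
  have hφ0 : ∀ k, ∀ x ∈ D \ K k, φ k x = 0 := by
    intro k x hx
    have : ‖s k • v x‖ ^ 2 ≤ 1 := by
      by_contra h
      exact hx.2 ⟨subset_closure hx.1, (not_le.1 h).le⟩
    simp [hφ, truncation_of_norm_le this]
  have hpφ : ∀ k b, ∀ y ∈ U b, partials (fun z => φ k ((e b).symm z)) y = fun i =>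
      fderiv ℝ truncation (s k • v ((e b).symm y))
        (partials (fun z => v ((e b).symm z)) y i) := by
    intro k b y hy
    funext i
    have hd := ((contDiffOn_comp_symm (he b) hvs).contDiffAt
      ((hU b).mem_nhds hy)).differentiableAt (by norm_num)
    have ht : HasFDerivAt truncation (fderiv ℝ truncation (s k • v ((e b).symm y)))
        (s k • v ((e b).symm y)) :=
      (contDiff_truncation.differentiable (by norm_num) _).hasFDerivAt
    have h1 := (ht.comp y (hd.hasFDerivAt.fun_const_smul (s k))).fun_const_smul (s k)⁻¹
    have h2 : HasFDerivAt (fun z => φ k ((e b).symm z)) _ y := h1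
    rw [partials, h2.fderiv]
    simp only [partials, _root_.smul_apply, ContinuousLinearMap.comp_apply, map_smul]
    rw [inv_smul_smul₀ (hs0 k)]
  set G : ℕ → t → EuclideanSpace ℝ (Fin m) → ℝ := fun k b y => χ b ((e b).symm y) *
    variationDensity (e b) f₁ (φ k) y - χ b ((e b).symm y) * variationDensity (e b) f₀ (φ k) y
    with hG
  have hint : ∀ (f : M → EuclideanSpace ℝ (Fin n)), ContMDiffOn (𝓡 m) (𝓡 n) ∞ f D → ∀ k b,
      IntegrableOn (fun y => χ b ((e b).symm y) * variationDensity (e b) f (φ k) y) (U b) := by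
    intro f hf k b
    refine integrableOn_mul_variationDensity (he b) hDo hf (hφs k) (hχ b).continuous
      ((hK k).inter_right (isClosed_tsupport (χ b))) (inter_subset_left.trans (hKD k))
      (inter_subset_right.trans (hsupp b)) fun y hy hyL => ?_
    by_cases hyK : (e b).symm y ∈ K k
    · rw [image_eq_zero_of_notMem_tsupport fun h => hyL ⟨hyK, h⟩, zero_mul]
    · rw [variationDensity_eq_zero (hDo.inter (hK k).isClosed.isOpen_compl)
        (fun x hx => hφ0 k x hx) hy.1 ⟨hy.2, hyK⟩, mul_zero]
  have hGsum : ∀ k, ∑ b, ∫ y in U b, G k b y = 0 := by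
    intro k
    have h1 := hf₁.sum_integral_variationDensity hDo he hχ hsupp hsumD (hφs k) (hK k) (hKD k) (hφ0 k)
    have h0 := hf₀.sum_integral_variationDensity hDo he hχ hsupp hsumD (hφs k) (hK k) (hKD k) (hφ0 k)
    rw [← sub_self (0 : ℝ)]
    nth_rewrite 1 [← h1]
    rw [← h0, ← Finset.sum_sub_distrib]
    exact Finset.sum_congr rfl fun b _ => integral_sub (hint f₁ hf₁.contMDiffOn k b)
      (hint f₀ hf₀.contMDiffOn k b)
  set H : t → EuclideanSpace ℝ (Fin m) → ℝ := fun b y => χ b ((e b).symm y) *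
    variationDensity (e b) f₁ v y - χ b ((e b).symm y) * variationDensity (e b) f₀ v y with hH
  classical
  -- The limit has to be cut off on the zero set of `v`: there the truncated maps have zero
  -- differential, while `v` itself may not.
  set Hc : t → EuclideanSpace ℝ (Fin m) → ℝ := fun b y =>
    if v ((e b).symm y) = 0 then 0 else H b y with hHc
  have hlim : ∀ b, ∀ y ∈ U b, Filter.Tendsto (fun k => G k b y) Filter.atTop (nhds (Hc b y)) := by
    intro b y hy
    by_cases h0 : v ((e b).symm y) = 0
    · have : ∀ k, G k b y = 0 := by
        intro k
        have hp : partials (fun z => φ k ((e b).symm z)) y = (0 : ℝ) • 0 := by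
          rw [hpφ k b y hy, h0, smul_zero, fderiv_truncation_zero]
          funext i
          simp
        simp only [hG, variationDensity]
        rw [hp, firstVariation_smul, firstVariation_smul]
        ring
      simp [hHc, h0, this]
    · simp only [hHc, if_neg h0]
      refine tendsto_const_nhds.congr' ?_
      filter_upwards [tendsto_fderiv_truncation h0] with k hk
      have hp : partials (fun z => φ k ((e b).symm z)) y
          = partials (fun z => v ((e b).symm z)) y := by
        rw [hpφ k b y hy]
        simp only [hs, hk]
        rfl
      simp only [hG, hH, variationDensity, hp]
  -- The set `U b` may reach the boundary of `D`, where nothing is known about derivatives. The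
  -- metric is controlled on the compact image of `closure D ∩ tsupport (χ b)`, and the partial
  -- derivatives by the global bounds `R₀` and `R₁`.
  have hbound : ∀ b, ∃ Bd : ℝ, ∀ k, ∀ y ∈ U b,
      ‖G k b y‖ ≤ ((e b) '' (closure D ∩ tsupport (χ b))).indicator (fun _ => Bd) y := by
    intro b
    set L := (e b) '' (closure D ∩ tsupport (χ b)) with hL
    have hLs : closure D ∩ tsupport (χ b) ⊆ (e b).source := inter_subset_right.trans (hsupp b)
    have hLc : IsCompact L := (hDb.inter_right (isClosed_tsupport (χ b))).image_of_continuousOn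
      ((e b).continuousOn.mono hLs)
    have hLt : L ⊆ (e b).target := by
      rintro _ ⟨z, hz, rfl⟩
      exact (e b).map_source (hLs hz)
    obtain ⟨r₀, hr₀, hP₀⟩ := exists_bound_partials hDo hf₀.contMDiffOn hR₀ (he b) hLc hLt
    obtain ⟨r₁, hr₁, hP₁⟩ := exists_bound_partials hDo hf₁.contMDiffOn hR₁ (he b) hLc hLt
    obtain ⟨B₀, hB₀⟩ := exists_bound_firstVariation (n := n) (he b) hLc hLt r₀ (|B| * (r₁ + r₀))
    obtain ⟨B₁, hB₁⟩ := exists_bound_firstVariation (n := n) (he b) hLc hLt r₁ (|B| * (r₁ + r₀))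
    refine ⟨B₁ + B₀, fun k y hy => ?_⟩
    by_cases hyL : y ∈ L
    · rw [indicator_of_mem hyL]
      have hχ1 : ‖χ b ((e b).symm y)‖ ≤ 1 := by
        rw [Real.norm_eq_abs, abs_of_nonneg (hχ0 b _), ← hsumD _ hy.2]
        exact Finset.single_le_sum (f := fun a => χ a ((e b).symm y)) (fun a _ => hχ0 a _)
          (Finset.mem_univ b)
      have hQ : ‖partials (fun z => φ k ((e b).symm z)) y‖ ≤ |B| * (r₁ + r₀) := by
        refine (pi_norm_le_iff_of_nonneg (by positivity)).2 fun i => ?_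
        rw [hpφ k b y hy]
        refine (hB _ _).trans (mul_le_mul (le_abs_self B) ?_ (norm_nonneg _) (abs_nonneg B))
        have d₀ := ((contDiffOn_comp_symm (he b) hf₀.contMDiffOn).contDiffAt
          ((hU b).mem_nhds hy)).differentiableAt (by norm_num)
        have d₁ := ((contDiffOn_comp_symm (he b) hf₁.contMDiffOn).contDiffAt
          ((hU b).mem_nhds hy)).differentiableAt (by norm_num)
        have hvp : partials (fun z => v ((e b).symm z)) y i
            = partials (fun z => f₁ ((e b).symm z)) y i
              - partials (fun z => f₀ ((e b).symm z)) y i := by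
          rw [partials, (d₁.hasFDerivAt.fun_sub d₀.hasFDerivAt).fderiv]
          rfl
        rw [hvp]
        exact (norm_sub_le _ _).trans (add_le_add
          ((norm_le_pi_norm _ i).trans (hP₁ y ⟨hyL, hy⟩))
          ((norm_le_pi_norm _ i).trans (hP₀ y ⟨hyL, hy⟩)))
      have h1 := hB₁ y hyL _ _ (hP₁ y ⟨hyL, hy⟩) hQ
      have h0 := hB₀ y hyL _ _ (hP₀ y ⟨hyL, hy⟩) hQ
      refine (norm_sub_le _ _).trans (add_le_add ?_ ?_)
      · rw [norm_mul]
        exact (mul_le_of_le_one_left (norm_nonneg _) hχ1).trans h1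
      · rw [norm_mul]
        exact (mul_le_of_le_one_left (norm_nonneg _) hχ1).trans h0
    · rw [indicator_of_notMem hyL]
      have : χ b ((e b).symm y) = 0 := image_eq_zero_of_notMem_tsupport fun h =>
        hyL ⟨_, ⟨subset_closure hy.2, h⟩, (e b).right_inv hy.1⟩
      simp [hG, this]
  choose Bd hBd using hbound
  have hHc0 : ∀ b, ∀ y ∈ U b, 0 ≤ Hc b y := by
    intro b y hy
    simp only [hHc]
    split_ifs
    · exact le_rfl
    · simp only [hH]
      rw [← mul_sub]
      exact mul_nonneg (hχ0 b _) (sub_nonneg.2 (variationDensity_gap hDo hCs hCc hCM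
        hf₀.contMDiffOn hf₁.contMDiffOn hC₀ hC₁ (he b) hy).1)
  have hae : ∀ b, Hc b =ᵐ[volume.restrict (U b)] 0 := by
    have hr : ∀ b {p : EuclideanSpace ℝ (Fin m) → Prop}, (∀ y ∈ U b, p y) →
        ∀ᵐ y ∂volume.restrict (U b), p y := fun b p hp =>
      ae_restrict_of_forall_mem (hU b).measurableSet hp
    refine ae_eq_zero_of_tendsto_of_sum_integral_eq_zero
      (g := fun b => ((e b) '' (closure D ∩ tsupport (χ b))).indicator fun _ => Bd b)
      (fun k b => ((hint f₁ hf₁.contMDiffOn k b).sub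
        (hint f₀ hf₀.contMDiffOn k b)).aestronglyMeasurable) (fun b => ?_)
      (fun k b => hr b (hBd b k)) (fun b => hr b (hlim b)) hGsum fun b => hr b (hHc0 b)
    have hLc : IsCompact ((e b) '' (closure D ∩ tsupport (χ b))) :=
      (hDb.inter_right (isClosed_tsupport (χ b))).image_of_continuousOn
        ((e b).continuousOn.mono (inter_subset_right.trans (hsupp b)))
    exact ((integrable_indicator_iff hLc.isClosed.measurableSet).2
      (integrableOn_const hLc.measure_lt_top.ne)).restrict
  obtain ⟨b, -, hb⟩ := Finset.exists_ne_zero_of_sum_ne_zero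
    ((hsumD x hx).trans_ne one_ne_zero)
  have hxs : x ∈ (e b).source := hsupp b (subset_tsupport _ hb)
  obtain ⟨y, hy, rfl⟩ : ∃ y ∈ (e b).target, (e b).symm y = x :=
    ⟨e b x, (e b).map_source hxs, (e b).left_inv hxs⟩
  have hUv : IsOpen (U b ∩ (fun z => v ((e b).symm z)) ⁻¹' {0}ᶜ) :=
    (contDiffOn_comp_symm (he b) hvs).continuousOn.isOpen_inter_preimage (hU b)
      isOpen_compl_singleton
  have hHcont : ContinuousOn (H b) (U b) := by
    have hχc : ContinuousOn (fun z => χ b ((e b).symm z)) (U b) :=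
      (hχ b).continuous.comp_continuousOn ((e b).symm.continuousOn.mono inter_subset_left)
    exact (hχc.mul (continuousOn_variationDensity (he b) hDo hf₁.contMDiffOn hvs)).sub
      (hχc.mul (continuousOn_variationDensity (he b) hDo hf₀.contMDiffOn hvs))
  -- On the open set where `v ≠ 0` the cutoff is inactive, so continuity upgrades vanishing almost
  -- everywhere to vanishing at each point.
  have hH0 : EqOn (H b) 0 (U b ∩ (fun z => v ((e b).symm z)) ⁻¹' {0}ᶜ) := by
    refine Measure.eqOn_open_of_ae_eq (μ := volume) ?_ hUv (hHcont.mono inter_subset_left)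
      continuousOn_const
    filter_upwards [ae_restrict_of_ae_restrict_of_subset inter_subset_left (hae b),
      ae_restrict_mem hUv.measurableSet] with z hz hzU
    rw [← hz]
    exact (if_neg hzU.2).symm
  have hyU : y ∈ U b := ⟨hy, hx⟩
  have h := hH0 ⟨hyU, hne⟩
  simp only [hH, ← mul_sub, Pi.zero_apply] at h
  exact (variationDensity_gap hDo hCs hCc hCM hf₀.contMDiffOn hf₁.contMDiffOn hC₀ hC₁ (he b)
    hyU).2 (sub_eq_zero.1 ((mul_eq_zero.1 h).resolve_left hb)).symm

end Uniqueness

/-! ### Constancy of `‖f₁ - f₀‖` and conclusion. -/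

theorem eventually_norm_sub_sq_eq {m n : ℕ} {M : Type*} [TopologicalSpace M]
    [ChartedSpace (EuclideanSpace ℝ (Fin m)) M] [IsManifold (𝓡 m) ∞ M] {D : Set M}
    (hD : IsOpen D) {f₀ f₁ : M → EuclideanSpace ℝ (Fin n)}
    (hf₀ : ContMDiffOn (𝓡 m) (𝓡 n) ∞ f₀ D) (hf₁ : ContMDiffOn (𝓡 m) (𝓡 n) ∞ f₁ D)
    (h : ∀ x ∈ D, f₁ x - f₀ x ≠ 0 → differential (m := m) f₀ x = differential (m := m) f₁ x)
    {x : M} (hx : x ∈ D) :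
    ∀ᶠ x' in nhds x, ‖f₁ x - f₀ x‖ ^ 2 = ‖f₁ x' - f₀ x'‖ ^ 2 := by
  set e := chartAt (EuclideanSpace ℝ (Fin m)) x with hed
  have he : e ∈ atlas (EuclideanSpace ℝ (Fin m)) M := chart_mem_atlas _ _
  have hxs : x ∈ e.source := mem_chart_source _ x
  set v : EuclideanSpace ℝ (Fin m) → EuclideanSpace ℝ (Fin n) :=
    fun y => f₁ (e.symm y) - f₀ (e.symm y) with hv
  have hU : IsOpen (e.target ∩ e.symm ⁻¹' D) := e.isOpen_inter_preimage_symm hD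
  have hxU : e x ∈ e.target ∩ e.symm ⁻¹' D :=
    ⟨e.map_source hxs, by simpa only [mem_preimage, e.left_inv hxs] using hx⟩
  have hder : ∀ y ∈ e.target ∩ e.symm ⁻¹' D, HasFDerivAt (fun y => ‖v y‖ ^ 2)
      (0 : EuclideanSpace ℝ (Fin m) →L[ℝ] ℝ) y := by
    intro y hy
    have d₀ := ((contDiffOn_comp_symm he hf₀).contDiffAt
      (hU.mem_nhds hy)).differentiableAt (by norm_num)
    have d₁ := ((contDiffOn_comp_symm he hf₁).contDiffAt
      (hU.mem_nhds hy)).differentiableAt (by norm_num)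
    have hd : HasFDerivAt v (fderiv ℝ (fun z => f₁ (e.symm z)) y
      - fderiv ℝ (fun z => f₀ (e.symm z)) y) y := d₁.hasFDerivAt.fun_sub d₀.hasFDerivAt
    refine hd.norm_sq.congr_fderiv ?_
    -- The derivative `2 ⟨v, dv⟩` vanishes in both cases: either `v = 0`, or `dv = 0` by the
    -- equality of differentials.
    by_cases hvy : v y = 0
    · ext z
      simp [hvy]
    · have hd0 : fderiv ℝ (fun z => f₁ (e.symm z)) y = fderiv ℝ (fun z => f₀ (e.symm z)) y := by
        have h₀ := partials_comp_symm he hy.1 (contMDiffAt_of_mem hD hf₀ hy.2)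
        have h₁ := partials_comp_symm he hy.1 (contMDiffAt_of_mem hD hf₁ hy.2)
        have hh := h _ hy.2 hvy
        refine ContinuousLinearMap.coe_injective
          ((EuclideanSpace.basisFun (Fin m) ℝ).toBasis.ext fun i => ?_)
        have h2 : differential (m := m) f₁ (e.symm y) (chartFrame e y i)
            = differential (m := m) f₀ (e.symm y) (chartFrame e y i) := by rw [hh]
        have := (congrFun h₁ i).trans (h2.trans (congrFun h₀ i).symm)
        simpa [partials] using this
      rw [hd0, sub_self]
      ext z
      simp
  obtain ⟨r, hr, hball⟩ := Metric.isOpen_iff.1 hU _ hxU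
  have hcont : ContinuousAt e x := e.continuousAt hxs
  filter_upwards [hcont.eventually (Metric.ball_mem_nhds _ hr), e.open_source.mem_nhds hxs]
    with x' hx' hxs'
  have hc := (convex_ball (e x) r).is_const_of_fderivWithin_eq_zero (𝕜 := ℝ)
    (f := fun y => ‖v y‖ ^ 2)
    (fun y hy => (hder y (hball hy)).differentiableAt.differentiableWithinAt)
    (fun y hy => ((hder y (hball hy)).hasFDerivWithinAt.fderivWithin
      (Metric.isOpen_ball.uniqueDiffWithinAt hy)))
    (Metric.mem_ball_self hr) hx'
  simpa only [hv, e.left_inv hxs, e.left_inv hxs'] using hc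

end MinimalMaps

end

theorem mainTheorem1 {m n : ℕ} {M : Type*} [TopologicalSpace M] [T2Space M]
    [SecondCountableTopology M] [ChartedSpace (EuclideanSpace ℝ (Fin m)) M]
    [IsManifold (𝓡 m) ∞ M]
    [RiemannianBundle (fun x : M ↦ TangentSpace (𝓡 m) x)]
    [IsContMDiffRiemannianBundle (𝓡 m) ∞ (EuclideanSpace ℝ (Fin m))
      (fun x : M ↦ TangentSpace (𝓡 m) x)]
    (D : Set M) (hDo : IsOpen D) (hDc : IsConnected D) (hDb : IsCompact (closure D))
    (hDf : (frontier D).Nonempty)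
    (C : Set (Fin m → ℝ)) (hCs : MinimalMaps.IsSymmetric C) (hCc : Convex ℝ C)
    (hCM : C ⊆ closure (MinimalMaps.setM m))
    (f₀ f₁ : M → EuclideanSpace ℝ (Fin n))
    (hc₀ : ContinuousOn f₀ (closure D)) (hc₁ : ContinuousOn f₁ (closure D))
    (hf₀ : MinimalMaps.IsMinimalMapOn m f₀ D) (hf₁ : MinimalMaps.IsMinimalMapOn m f₁ D)
    (hbd : EqOn f₀ f₁ (frontier D))
    (hC₀ : ∀ x ∈ D, MinimalMaps.singularValueVector f₀ x ∈ C)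
    (hC₁ : ∀ x ∈ D, MinimalMaps.singularValueVector f₁ x ∈ C) :
    EqOn f₀ f₁ (closure D) := by
  have hloc : ∀ x ∈ D, ∀ x' ∈ D, ‖f₁ x - f₀ x‖ ^ 2 = ‖f₁ x' - f₀ x'‖ ^ 2 := fun x hx x' hx' =>
    hDc.isPreconnected.induction₂ (fun x y => ‖f₁ x - f₀ x‖ ^ 2 = ‖f₁ y - f₀ y‖ ^ 2)
      (fun _ hx => mem_nhdsWithin_of_mem_nhds (MinimalMaps.eventually_norm_sub_sq_eq hDo
        hf₀.contMDiffOn hf₁.contMDiffOn (fun _ hx hne => MinimalMaps.differential_eq_of_ne hDo hDc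
          hDb hCs hCc hCM hc₀ hc₁ hf₀ hf₁ hbd hC₀ hC₁ hx hne) hx))
      (fun _ _ _ _ _ _ h h' => h.trans h') (fun _ _ _ _ h => h.symm) hx hx'
  obtain ⟨p, hp⟩ := hDf
  -- Continuity carries the constant value to the closure, where the boundary point `p` identifies
  -- it as `0`.
  have hzero : ∀ x ∈ D, ∀ q ∈ closure D, ‖f₁ x - f₀ x‖ ^ 2 = ‖f₁ q - f₀ q‖ ^ 2 := fun x hx =>
    EqOn.of_subset_closure (s := D) (fun x' hx' => hloc x hx x' hx') continuousOn_const
      ((hc₁.sub hc₀).norm.pow 2) subset_closure Subset.rfl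
  intro x hx
  by_cases hxD : x ∈ D
  · have h := hzero x hxD p (frontier_subset_closure hp)
    rw [hbd hp, sub_self, norm_zero, zero_pow two_ne_zero, sq_eq_zero_iff, norm_eq_zero,
      sub_eq_zero] at h
    exact h.symm
  · exact hbd (by rw [hDo.frontier_eq]; exact ⟨hx, hxD⟩)
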